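/- Let $\lambda>1$, $\beta>0$, and let $a=(a_n)_{n\ge1}$ be a real sequence with $\sum_{n\ge1}a_n^2<\infty$. If $\beta>2$, assume in addition that $a_n=o(\lambda^{(2-\beta)n})$ as $n\to\infty$, or, more generally, only that $$\limsup_{n\to\infty}|a_n|\,\lambda^{(\beta-2)n}<\varepsilon:=\min\left(\frac1{\lambda^2+\lambda^{\beta-1}},\ \frac1{\lambda^2+\lambda^{2\beta-4}}\right).$$ Consider the viscous dyadic system $$\dot u_n(t)+\lambda^{2n}u_n(t)-\lambda^{\beta n}u_{n-1}(t)^2+\lambda^{\beta(n+1)}u_n(t)u_{n+1}(t)=0,\quad t\in[0,\infty),\qquad u_n(0)=a_n,\qquad n=1,2,\dots,$$ where $u_0\equiv0$. A Leray–Hopf solution is a sequence of real functions $u_n\in C^\infty[0,\infty)$, $n\ge1$, that satisfies this system and the energy inequality $$\sum_{n=1}^\infty\left(u_n(t)^2+2\int_0^t\lambda^{2n}u_n(\tau)^2\,d\tau\right)\le\sum_{n=1}^\infty a_n^2\qquad\text{for all }t\in[0,\infty).$$ Then the system has exactly one Leray–Hopf solution: one exists, and any two of them coincide, $u_n(t)=v_n(t)$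 for all $n\ge1$ and $t\ge0$. -/

import Mathlib

open Set Filter Asymptotics
open scoped Topology ContDiff

namespace Dyadic

/-- `u` is a weak solution on `[0, ∞)` of the viscous dyadic system with initial data
`(a n)`, `n = 1, 2, …`.  The component with index `0` is the convention `u₀ ≡ 0`; the value `a 0`
plays no role.  Only the values `u n t` with `0 ≤ t` matter, and derivatives at `0` are
one-sided. -/
structure IsWeakSolution (lam β : ℝ) (a : ℕ → ℝ) (u : ℕ → ℝ → ℝ) : Prop where
  zero_index : ∀ t, 0 ≤ t → u 0 t = 0
  smooth : ∀ n, 1 ≤ n → ContDiffOn ℝ ∞ (u n) (Ici 0)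
  equation : ∀ n, 1 ≤ n → ∀ t, 0 ≤ t →
    derivWithin (u n) (Ici 0) t + lam ^ (2 * n) * u n t
      - lam ^ (β * (n : ℝ)) * u (n - 1) t ^ 2
      + lam ^ (β * ((n : ℝ) + 1)) * u n t * u (n + 1) t = 0
  initial : ∀ n, 1 ≤ n → u n 0 = a n

/-- The `n`-th term `u_n(t)² + 2 ∫₀ᵗ λ²ⁿ u_n(τ)² dτ` of the energy. -/
noncomputable def energyTerm (lam : ℝ) (u : ℕ → ℝ → ℝ) (n : ℕ) (t : ℝ) : ℝ :=
  u n t ^ 2 + 2 * ∫ τ in (0 : ℝ)..t, lam ^ (2 * n) * u n τ ^ 2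

/-- A Leray–Hopf solution (for square-summable `(a n)`): a weak solution that satisfies the energy
inequality at every `t ≥ 0`.  The sums over the indices `1, 2, …` are written with `n + 1`,
`n = 0, 1, …`. -/
structure IsLerayHopfSolution (lam β : ℝ) (a : ℕ → ℝ) (u : ℕ → ℝ → ℝ) : Prop where
  weak : IsWeakSolution lam β a u
  summable_energy : ∀ t, 0 ≤ t → Summable fun n : ℕ => energyTerm lam u (n + 1) t
  energy_le : ∀ t, 0 ≤ t →
    ∑' n : ℕ, energyTerm lam u (n + 1) t ≤ ∑' n : ℕ, a (n + 1) ^ 2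

/-- The explicit constant `ε = min (1 / (λ² + λ^(β-1))) (1 / (λ² + λ^(2β-4)))`. -/
noncomputable def smallnessConst (lam β : ℝ) : ℝ :=
  min (1 / (lam ^ 2 + lam ^ (β - 1))) (1 / (lam ^ 2 + lam ^ (2 * β - 4)))

end Dyadic

/-! Write ρ = λ^β and, for β > 2, θ = λ^(2-β), so that ρθ = λ². The energy flux from mode M to mode
M + 1 is ρ^(M+1) u_M² u_(M+1). It can bring energy back from high modes only where these are
negative, so uniqueness rests on one-sided bounds for high modes.

The core is `eq_of_lower_bound`: two solutions that agree at time s coincide later if ρ^(n+1)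
u_(n+1) ≥ -λ^(2n) for all large n in both. In the time derivative of ∑ 2^(-n) (u_n - v_n)² the mixed
products of consecutive differences cancel, and the lower bound gives the high diagonal terms a good
sign. The truncation at M leaves a boundary term of size 2^(-M) times cubes ρ^n |u_n|³, whose time
integrals are bounded uniformly in n (`exists_integral_cube_le`). Grönwall and M → ∞ finish.

The lower bound comes from the energy inequality. A nonnegative mode stays nonnegative, so a mode
negative at t was not positive on [s, t]. The modes below it then lost nothing through the flux, and
its square is at most the energy lying above them at time s (`sq_le_of_neg`). `TailSmall` says that
this energy is small enough. For β ≤ 2 it holds at s = 0, because the tails of ∑ a_n² tend to 0.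

For β > 2 it need not hold at s = 0. The solution built by `exists_sol`, a limit of Galerkin
truncations, satisfies |u_n| ≤ B θ^n for n ≥ N on a short [0, T], and `weak_strong_uniqueness` makes
every Leray–Hopf solution agree with it there. The dissipation improves the bound to u_n(T) = o(θ^n)
(`smoothing`) and energy is conserved up to dissipation on [0, T], so `TailSmall` holds at T and the
core applies from T on. Of the two entries of ε, the first absorbs the interaction in weak-strong
uniqueness, the second makes B θ^n a barrier for the dynamics. -/

namespace DyadicModel

/-! ### Truncated energy balance and its consequences. -/

open Finset (range)

/-- The right-hand side of the dyadic system, with `ρ = lam ^ β`. -/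
def vf (lam ρ : ℝ) (x : ℕ → ℝ) (n : ℕ) : ℝ :=
  -(lam ^ (2 * n) * x n) + ρ ^ n * x (n - 1) ^ 2 - ρ ^ (n + 1) * x n * x (n + 1)

/-- A family of continuous functions whose restriction to `[0, ∞)` solves the dyadic system. -/
structure Sol (lam ρ : ℝ) (u : ℕ → ℝ → ℝ) : Prop where
  cont : ∀ n, Continuous (u n)
  zero : ∀ t, u 0 t = 0
  deriv : ∀ n t, 0 ≤ t → HasDerivWithinAt (u n) (vf lam ρ (fun m => u m t) n) (Ici t) t

/-- The energy dissipated by the `n`-th mode during `[a, b]`. -/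
noncomputable def diss (lam : ℝ) (u : ℕ → ℝ → ℝ) (n : ℕ) (a b : ℝ) : ℝ :=
  ∫ τ in a..b, lam ^ (2 * n) * u n τ ^ 2

/-- The energy inequality with constant `A`, in terms of partial sums. -/
def EnergyLe (lam : ℝ) (u : ℕ → ℝ → ℝ) (A : ℝ) : Prop :=
  ∀ M t, 0 ≤ t → ∑ n ∈ range M, (u n t ^ 2 + 2 * diss lam u n 0 t) ≤ A

/-- The transfer terms telescope, leaving only the flux out of mode M. -/
lemma energy_algebra (lam ρ : ℝ) (x : ℕ → ℝ) (h0 : x 0 = 0) (M : ℕ) :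
    ∑ n ∈ range (M + 1), 2 * x n * vf lam ρ x n =
      -2 * ∑ n ∈ range (M + 1), lam ^ (2 * n) * x n ^ 2
        - 2 * (ρ ^ (M + 1) * x M ^ 2 * x (M + 1)) := by
  induction M with
  | zero => simp [h0]
  | succ M ih =>
    rw [Finset.sum_range_succ, ih, Finset.sum_range_succ _ (M + 1)]
    simp only [vf, Nat.add_sub_cancel]
    ring

lemma integral_eq_of_right_deriv {f g : ℝ → ℝ} {a b : ℝ} (hab : a ≤ b) (hf : Continuous f)
    (hg : Continuous g) (h : ∀ t, a ≤ t → HasDerivWithinAt f (g t) (Ici t) t) :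
    ∫ t in a..b, g t = f b - f a :=
  intervalIntegral.integral_eq_sub_of_hasDeriv_right_of_le hab hf.continuousOn
    (fun t ht => (h t ht.1.le).mono Ioi_subset_Ici_self) (hg.intervalIntegrable _ _)

lemma sub_le_integral_of_right_deriv {f f' g : ℝ → ℝ} {a b : ℝ} (hab : a ≤ b) (hf : Continuous f)
    (hg : Continuous g) (h : ∀ t ∈ Ico a b, HasDerivWithinAt f (f' t) (Ici t) t)
    (hle : ∀ t ∈ Ico a b, f' t ≤ g t) : f b - f a ≤ ∫ t in a..b, g t :=
  intervalIntegral.sub_le_integral_of_hasDeriv_right_of_le hab hf.continuousOn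
    (fun t ht => (h t ⟨ht.1.le, ht.2⟩).mono Ioi_subset_Ici_self)
    hg.continuousOn.integrableOn_Icc (fun t ht => hle t ⟨ht.1.le, ht.2⟩)

lemma integral_add_cont {f g : ℝ → ℝ} {a b : ℝ} (hf : Continuous f) (hg : Continuous g) :
    ∫ t in a..b, (f t + g t) = (∫ t in a..b, f t) + ∫ t in a..b, g t :=
  intervalIntegral.integral_add (hf.intervalIntegrable _ _) (hg.intervalIntegrable _ _)

lemma integral_sub_cont {f g : ℝ → ℝ} {a b : ℝ} (hf : Continuous f) (hg : Continuous g) :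
    ∫ t in a..b, (f t - g t) = (∫ t in a..b, f t) - ∫ t in a..b, g t :=
  intervalIntegral.integral_sub (hf.intervalIntegrable _ _) (hg.intervalIntegrable _ _)

lemma integral_mono_Icc {f g : ℝ → ℝ} {a b : ℝ} (hab : a ≤ b) (hf : Continuous f)
    (hg : Continuous g) (h : ∀ t ∈ Icc a b, f t ≤ g t) :
    ∫ t in a..b, f t ≤ ∫ t in a..b, g t :=
  intervalIntegral.integral_mono_on hab (hf.intervalIntegrable _ _) (hg.intervalIntegrable _ _) h

lemma abs_integral_le {f g : ℝ → ℝ} {a b : ℝ} (hab : a ≤ b) (hf : Continuous f)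
    (hg : Continuous g) (h : ∀ t ∈ Icc a b, |f t| ≤ g t) :
    |∫ t in a..b, f t| ≤ ∫ t in a..b, g t :=
  (intervalIntegral.abs_integral_le_integral_abs hab).trans (integral_mono_Icc hab hf.abs hg h)

lemma continuous_vf {lam ρ : ℝ} {u : ℕ → ℝ → ℝ} (hu : ∀ n, Continuous (u n)) (n : ℕ) :
    Continuous fun t => vf lam ρ (fun m => u m t) n := by
  have h1 := hu n
  have h2 := hu (n - 1)
  have h3 := hu (n + 1)
  unfold vf
  fun_prop

lemma diss_nonneg (lam : ℝ) (u : ℕ → ℝ → ℝ) (n : ℕ) {a b : ℝ} (hab : a ≤ b) :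
    0 ≤ diss lam u n a b :=
  intervalIntegral.integral_nonneg hab fun _ _ =>
    mul_nonneg ((even_two_mul n).pow_nonneg lam) (sq_nonneg _)

lemma continuous_diss_integrand (lam : ℝ) {u : ℕ → ℝ → ℝ} (hu : ∀ n, Continuous (u n)) (n : ℕ) :
    Continuous fun τ => lam ^ (2 * n) * u n τ ^ 2 := by
  have := hu n
  fun_prop

lemma diss_add (lam : ℝ) {u : ℕ → ℝ → ℝ} (hu : ∀ n, Continuous (u n)) (n : ℕ) (a b c : ℝ) :
    diss lam u n a b + diss lam u n b c = diss lam u n a c :=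
  intervalIntegral.integral_add_adjacent_intervals
    ((continuous_diss_integrand lam hu n).intervalIntegrable _ _)
    ((continuous_diss_integrand lam hu n).intervalIntegrable _ _)

lemma diss_mono (lam : ℝ) {u : ℕ → ℝ → ℝ} (hu : ∀ n, Continuous (u n)) (n : ℕ) {a b c d : ℝ}
    (h1 : a ≤ b) (h3 : c ≤ d) : diss lam u n b c ≤ diss lam u n a d := by
  have e1 := diss_add lam hu n a b c
  have e2 := diss_add lam hu n a c d
  have p1 := diss_nonneg lam u n h1
  have p2 := diss_nonneg lam u n h3
  linarith

namespace EnergyLe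

variable {lam A : ℝ} {u : ℕ → ℝ → ℝ}

lemma nonneg (h : EnergyLe lam u A) : 0 ≤ A := by simpa using h 0 0 le_rfl

lemma sum_sq_le (h : EnergyLe lam u A) (M : ℕ) {t : ℝ} (ht : 0 ≤ t) :
    ∑ n ∈ range M, u n t ^ 2 ≤ A :=
  (Finset.sum_le_sum fun n _ => by
    have := diss_nonneg lam u n ht
    linarith).trans (h M t ht)

lemma sq_le (h : EnergyLe lam u A) (n : ℕ) {t : ℝ} (ht : 0 ≤ t) : u n t ^ 2 ≤ A :=
  (Finset.single_le_sum (f := fun n => u n t ^ 2) (fun _ _ => sq_nonneg _)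
    (Finset.self_mem_range_succ n)).trans (h.sum_sq_le (n + 1) ht)

lemma abs_le (h : EnergyLe lam u A) (n : ℕ) {t : ℝ} (ht : 0 ≤ t) : |u n t| ≤ √A :=
  Real.abs_le_sqrt (h.sq_le n ht)

lemma sum_diss_le (h : EnergyLe lam u A) (hu : ∀ n, Continuous (u n)) (M : ℕ) {a b : ℝ}
    (ha : 0 ≤ a) (hab : a ≤ b) : ∑ n ∈ range M, diss lam u n a b ≤ A / 2 := by
  have h1 : ∑ n ∈ range M, 2 * diss lam u n a b ≤ A :=
    (Finset.sum_le_sum fun n _ => by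
      have := diss_mono lam hu n ha (le_refl b)
      have := sq_nonneg (u n b)
      linarith).trans (h M b (ha.trans hab))
  rw [← Finset.mul_sum] at h1
  linarith

lemma diss_le (h : EnergyLe lam u A) (hu : ∀ n, Continuous (u n)) (n : ℕ) {a b : ℝ}
    (ha : 0 ≤ a) (hab : a ≤ b) : diss lam u n a b ≤ A / 2 :=
  (Finset.single_le_sum (f := fun n => diss lam u n a b) (fun _ _ => diss_nonneg lam u _ hab)
    (Finset.self_mem_range_succ n)).trans (h.sum_diss_le hu (n + 1) ha hab)

lemma tendsto_diss (h : EnergyLe lam u A) (hu : ∀ n, Continuous (u n)) {a b : ℝ}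
    (ha : 0 ≤ a) (hab : a ≤ b) : Tendsto (fun n => diss lam u n a b) atTop (𝓝 0) :=
  (summable_of_sum_range_le (fun _ => diss_nonneg lam u _ hab)
    (fun M => h.sum_diss_le hu M ha hab)).tendsto_atTop_zero

end EnergyLe

lemma hasDerivWithinAt_sum_sq {x x' : ℕ → ℝ → ℝ} {t : ℝ} (s : Set ℝ) (c : ℕ → ℝ) (M : ℕ)
    (h : ∀ n < M, HasDerivWithinAt (x n) (x' n t) s t) :
    HasDerivWithinAt (fun t => ∑ n ∈ range M, c n * x n t ^ 2)
      (∑ n ∈ range M, c n * (2 * x n t * x' n t)) s t :=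
  HasDerivWithinAt.fun_sum fun n hn => by
    refine (((h n (Finset.mem_range.1 hn)).fun_pow 2).const_mul (c n)).congr_deriv ?_
    norm_num

/-- Energy balance of the first `M + 1` modes. -/
lemma energy_identity {lam ρ : ℝ} {u : ℕ → ℝ → ℝ} (hu : ∀ n, Continuous (u n))
    (h0 : ∀ t, u 0 t = 0) (M : ℕ) {a b : ℝ} (hab : a ≤ b)
    (hd : ∀ n ≤ M, ∀ t ∈ Ico a b, HasDerivWithinAt (u n) (vf lam ρ (fun m => u m t) n) (Ici t) t) :
    ∑ n ∈ range (M + 1), u n b ^ 2 + 2 * ∑ n ∈ range (M + 1), diss lam u n a b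
      + 2 * ∫ t in a..b, ρ ^ (M + 1) * u M t ^ 2 * u (M + 1) t
      = ∑ n ∈ range (M + 1), u n a ^ 2 := by
  have h1 : ∀ t ∈ Ioo a b, HasDerivWithinAt (fun t => ∑ n ∈ range (M + 1), 1 * u n t ^ 2)
      (∑ n ∈ range (M + 1), 1 * (2 * u n t * vf lam ρ (fun m => u m t) n)) (Ioi t) t :=
    fun t ht => hasDerivWithinAt_sum_sq (x' := fun n t => vf lam ρ (fun m => u m t) n) _ _ _
      fun n hn => (hd n (Nat.lt_succ_iff.1 hn) t ⟨ht.1.le, ht.2⟩).mono Ioi_subset_Ici_self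
  have hc : Continuous fun t => ∑ n ∈ range (M + 1), 1 * (2 * u n t * vf lam ρ (fun m => u m t) n) :=
    continuous_finsetSum _ fun n _ => by
      have := hu n
      have := continuous_vf (lam := lam) (ρ := ρ) hu n
      fun_prop
  have h2 := intervalIntegral.integral_eq_sub_of_hasDeriv_right_of_le hab
    (Continuous.continuousOn (continuous_finsetSum _ fun n _ => by have := hu n; fun_prop)) h1
    (hc.intervalIntegrable _ _)
  have h3 : ∀ t, ∑ n ∈ range (M + 1), 1 * (2 * u n t * vf lam ρ (fun m => u m t) n) =
      -2 * ∑ n ∈ range (M + 1), lam ^ (2 * n) * u n t ^ 2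
        - 2 * (ρ ^ (M + 1) * u M t ^ 2 * u (M + 1) t) := fun t => by
    rw [← energy_algebra lam ρ (fun m => u m t) (h0 t) M]
    simp
  simp only [h3] at h2
  have i1 : ∀ n ∈ range (M + 1), IntervalIntegrable (fun t => lam ^ (2 * n) * u n t ^ 2)
      MeasureTheory.volume a b :=
    fun n _ => (continuous_diss_integrand lam hu n).intervalIntegrable _ _
  have c1 : Continuous fun t => ∑ n ∈ range (M + 1), lam ^ (2 * n) * u n t ^ 2 :=
    continuous_finsetSum _ fun n _ => continuous_diss_integrand lam hu n
  have c2 : Continuous fun t => ρ ^ (M + 1) * u M t ^ 2 * u (M + 1) t := by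
    have := hu M
    have := hu (M + 1)
    fun_prop
  rw [integral_sub_cont (c1.const_mul (-2)) (c2.const_mul 2), intervalIntegral.integral_const_mul,
    intervalIntegral.integral_const_mul, intervalIntegral.integral_finsetSum i1] at h2
  simp only [one_mul] at h2
  unfold diss
  linarith

lemma Sol.energy_identity {lam ρ : ℝ} {u : ℕ → ℝ → ℝ} (hu : Sol lam ρ u) (M : ℕ) {a b : ℝ}
    (ha : 0 ≤ a) (hab : a ≤ b) :
    ∑ n ∈ range (M + 1), u n b ^ 2 + 2 * ∑ n ∈ range (M + 1), diss lam u n a b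
      + 2 * ∫ t in a..b, ρ ^ (M + 1) * u M t ^ 2 * u (M + 1) t
      = ∑ n ∈ range (M + 1), u n a ^ 2 :=
  DyadicModel.energy_identity hu.cont hu.zero M hab fun n _ t ht => hu.deriv n t (ha.trans ht.1)

end DyadicModel

/-! ### Uniform time integrals of the cubes under a lower bound on the high modes. -/

namespace DyadicModel

open Finset (range)

/-- A sequence of at most geometric growth that is controlled by small multiples of its later terms
is bounded. -/
lemma le_two_mul_of_recursive_bound {G : ℕ → ℝ} {N : ℕ} {B C ρ η : ℝ} (hρ : 0 ≤ ρ) (hB : 0 ≤ B)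
    (hC : 0 ≤ C) (hη : 0 ≤ η) (hη4 : η ≤ 1 / 4) (hηρ : η * (ρ + ρ ^ 2) ≤ 1 / 2)
    (hgrow : ∀ n, G n ≤ B * ρ ^ n) (hrec : ∀ n, N ≤ n → G n ≤ C + η * (G (n + 1) + G (n + 2)))
    {n : ℕ} (hn : N ≤ n) : G n ≤ 2 * C := by
  -- Each use of the recursion keeps the level 2C, since 4η ≤ 1, and halves the geometric remainder,
  -- since η(ρ + ρ²) ≤ 1/2.
  have key : ∀ j : ℕ, ∀ n, N ≤ n → G n ≤ 2 * C + B * (1 / 2) ^ j * ρ ^ n := by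
    intro j
    induction j with
    | zero => intro n _; have := hgrow n; simp; linarith
    | succ j ih =>
      intro n hn
      have h1 := ih (n + 1) (by omega)
      have h2 := ih (n + 2) (by omega)
      have hP : 0 ≤ B * (1 / 2) ^ j * ρ ^ n := by positivity
      calc G n ≤ C + η * (G (n + 1) + G (n + 2)) := hrec n hn
        _ ≤ C + η * ((2 * C + B * (1 / 2) ^ j * ρ ^ (n + 1))
              + (2 * C + B * (1 / 2) ^ j * ρ ^ (n + 2))) := by gcongr
        _ = C + η * (4 * C) + η * (ρ + ρ ^ 2) * (B * (1 / 2) ^ j * ρ ^ n) := by ring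
        _ ≤ C + 1 / 4 * (4 * C) + 1 / 2 * (B * (1 / 2) ^ j * ρ ^ n) := by gcongr
        _ = _ := by ring
  have hlim : Tendsto (fun j : ℕ => 2 * C + B * (1 / 2 : ℝ) ^ j * ρ ^ n) atTop
      (𝓝 (2 * C + B * 0 * ρ ^ n)) :=
    (((tendsto_pow_atTop_nhds_zero_of_lt_one (by norm_num) (by norm_num)).const_mul B).mul_const
      _).const_add _
  have := ge_of_tendsto' hlim fun j => key j n hn
  simpa using this

lemma mul_abs_le_of_lower {k D y : ℝ} (h : -D ≤ k * y) (hD : 0 ≤ D) :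
    k * |y| ≤ k * y + 2 * D := by
  rcases abs_cases y with ⟨h1, _⟩ | ⟨h1, h2⟩ <;> rw [h1] <;> linarith

lemma sq_mul_le_cubes {x z : ℝ} (hx : 0 ≤ x) (hz : 0 ≤ z) : x ^ 2 * z ≤ x ^ 3 + z ^ 3 := by
  rcases le_total x z with h | h
  · have : x ^ 2 * z ≤ z ^ 2 * z := by gcongr
    have : 0 ≤ x ^ 3 := by positivity
    nlinarith
  · have : x ^ 2 * z ≤ x ^ 2 * x := by gcongr
    have : 0 ≤ z ^ 3 := by positivity
    nlinarith

/-- Pointwise bound of a cube by the derivative `q` of the product of two consecutive modes,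
dissipation, energy flux and small multiples of cubes. -/
lemma cube_le {ρ K D L m p x y z q : ℝ} (hρ : 0 < ρ) (hK : 0 ≤ K) (hD : 0 ≤ D) (hL : 1 ≤ L)
    (hm : 0 < m) (hx : -D ≤ K * x) (hy : -(L * D) ≤ ρ * K * y)
    (hq : q = y * (-(L * D * x) + K * p ^ 2 - ρ * K * x * y)
      + x * (-(L ^ 2 * D * y) + ρ * K * x ^ 2 - ρ ^ 2 * K * y * z)) :
    ρ * (K * |x| ^ 3) ≤ q + (L / ρ + 1 + L + 2 * ρ) * (D * p ^ 2 + L * D * x ^ 2 + L ^ 2 * D * y ^ 2)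
      + m / 2 * (ρ * K * x ^ 2 * |y| + ρ ^ 2 * K * y ^ 2 * |z|)
      + 1 / (2 * m) * (ρ * K * |y| ^ 3 + ρ ^ 2 * (K * |x| ^ 3) + ρ ^ 2 * K * |z| ^ 3) := by
  have hL0 : 0 ≤ L := by linarith
  have hLD : 0 ≤ L * D := mul_nonneg hL0 hD
  have t1 : ρ * (K * |x| ^ 3) ≤ ρ * (K * x ^ 3) + 2 * ρ * (L * D * x ^ 2) := by
    have h := mul_abs_le_of_lower hx hD
    have h2 : K * |x| ^ 3 ≤ K * x ^ 3 + 2 * (D * x ^ 2) := by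
      have := mul_le_mul_of_nonneg_right h (sq_nonneg x)
      rw [pow_succ, sq_abs]
      nlinarith
    have h3 : D * x ^ 2 ≤ L * D * x ^ 2 := by
      have : D ≤ L * D := le_mul_of_one_le_left hD hL
      gcongr
    have := mul_le_mul_of_nonneg_left (h2.trans (add_le_add le_rfl
      (mul_le_mul_of_nonneg_left h3 (by norm_num : (0 : ℝ) ≤ 2)))) hρ.le
    linarith
  have t2 : (L * D + L ^ 2 * D) * (x * y) ≤ (1 + L) * (L * D * x ^ 2 + L ^ 2 * D * y ^ 2) := by
    have h1 : x * y ≤ (x ^ 2 + y ^ 2) / 2 := by nlinarith [sq_nonneg (x - y)]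
    have h2 : L * D * y ^ 2 ≤ L ^ 2 * D * y ^ 2 := by
      have : L * D ≤ L ^ 2 * D := by nlinarith
      gcongr
    have h3 : 0 ≤ L * D * x ^ 2 := by positivity
    have h4 : 0 ≤ L ^ 2 * D * y ^ 2 := by positivity
    calc (L * D + L ^ 2 * D) * (x * y) ≤ (L * D + L ^ 2 * D) * ((x ^ 2 + y ^ 2) / 2) := by gcongr
      _ = (1 + L) * ((L * D * x ^ 2 + L * D * y ^ 2) / 2) := by ring
      _ ≤ _ := by
        gcongr
        linarith
  have t3 : -(K * p ^ 2 * y) ≤ L / ρ * (D * p ^ 2) := by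
    have : -(K * y) ≤ L / ρ * D := by
      rw [div_mul_eq_mul_div, le_div_iff₀ hρ]
      linarith
    have := mul_le_mul_of_nonneg_right this (sq_nonneg p)
    linarith
  -- Young's inequality with weight m: the flux part may have a large coefficient, as its integral
  -- is bounded, while the cubes get a small one.
  have t4 : ρ * K * x * y ^ 2 ≤ m / 2 * (ρ * K * x ^ 2 * |y|) + 1 / (2 * m) * (ρ * K * |y| ^ 3) := by
    have h1 : x * y ^ 2 ≤ |y| * (m / 2 * x ^ 2 + 1 / (2 * m) * |y| ^ 2) := by
      have e : x * y ^ 2 ≤ |x| * |y| ^ 2 := by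
        rw [sq_abs]; gcongr; exact le_abs_self x
      have e2 : |x| * |y| ≤ m / 2 * x ^ 2 + 1 / (2 * m) * |y| ^ 2 := by
        have : m / 2 * x ^ 2 + 1 / (2 * m) * |y| ^ 2 - |x| * |y| = (m * |x| - |y|) ^ 2 / (2 * m) := by
          rw [← sq_abs x]; field_simp; ring
        have : 0 ≤ (m * |x| - |y|) ^ 2 / (2 * m) := by positivity
        linarith
      have := mul_le_mul_of_nonneg_left e2 (abs_nonneg y)
      linarith
    have := mul_le_mul_of_nonneg_left h1 (mul_nonneg hρ.le hK)
    linarith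
  have t5 : ρ ^ 2 * K * x * y * z ≤ m / 2 * (ρ ^ 2 * K * y ^ 2 * |z|)
      + 1 / (2 * m) * (ρ ^ 2 * (K * |x| ^ 3) + ρ ^ 2 * K * |z| ^ 3) := by
    have e1 : x * y * z ≤ |x| * |y| * |z| := by
      rw [← abs_mul, ← abs_mul]; exact le_abs_self _
    have e2 : |x| * |y| ≤ m / 2 * y ^ 2 + 1 / (2 * m) * |x| ^ 2 := by
      have : m / 2 * y ^ 2 + 1 / (2 * m) * |x| ^ 2 - |x| * |y| = (m * |y| - |x|) ^ 2 / (2 * m) := by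
        rw [← sq_abs y]; field_simp; ring
      have : 0 ≤ (m * |y| - |x|) ^ 2 / (2 * m) := by positivity
      linarith
    have e3 := mul_le_mul_of_nonneg_right e2 (abs_nonneg z)
    have e4 := mul_le_mul_of_nonneg_left (sq_mul_le_cubes (abs_nonneg x) (abs_nonneg z))
      (by positivity : 0 ≤ 1 / (2 * m))
    have h1 : x * y * z ≤ m / 2 * (y ^ 2 * |z|) + 1 / (2 * m) * (|x| ^ 3 + |z| ^ 3) := by linarith
    have := mul_le_mul_of_nonneg_left h1 (by positivity : 0 ≤ ρ ^ 2 * K)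
    linarith
  have c1 : 0 ≤ (1 + L + 2 * ρ) * (D * p ^ 2) := by positivity
  have c2 : 0 ≤ (L / ρ) * (L * D * x ^ 2) := by positivity
  have c3 : 0 ≤ (L / ρ + 2 * ρ) * (L ^ 2 * D * y ^ 2) := by positivity
  have e : ρ * (K * x ^ 3) = q + (L * D + L ^ 2 * D) * (x * y) - K * p ^ 2 * y + ρ * K * x * y ^ 2
      + ρ ^ 2 * K * x * y * z := by
    rw [hq]; ring
  linarith

lemma integral_le_of_pointwise {q d₀ d₁ d₂ f₁ f₂ g₁ g₂ g₃ : ℝ → ℝ} {a b r s c m k : ℝ}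
    (hab : a ≤ b) (hq : Continuous q) (hd₀ : Continuous d₀) (hd₁ : Continuous d₁)
    (hd₂ : Continuous d₂) (hf₁ : Continuous f₁) (hf₂ : Continuous f₂) (hg₁ : Continuous g₁)
    (hg₂ : Continuous g₂) (hg₃ : Continuous g₃)
    (h : ∀ t ∈ Icc a b, r * g₁ t ≤ q t + c * (d₀ t + (d₁ t + d₂ t)) + m * (f₁ t + f₂ t)
      + k * (g₂ t + (s * g₁ t + g₃ t))) :
    r * (∫ t in a..b, g₁ t) ≤ (∫ t in a..b, q t)
      + c * ((∫ t in a..b, d₀ t) + ((∫ t in a..b, d₁ t) + ∫ t in a..b, d₂ t))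
      + m * ((∫ t in a..b, f₁ t) + ∫ t in a..b, f₂ t)
      + k * ((∫ t in a..b, g₂ t) + (s * (∫ t in a..b, g₁ t) + ∫ t in a..b, g₃ t)) := by
  have hint := integral_mono_Icc hab (by fun_prop) (by fun_prop) h
  rw [integral_add_cont (by fun_prop) (by fun_prop), integral_add_cont (by fun_prop) (by fun_prop),
    integral_add_cont (by fun_prop) (by fun_prop)] at hint
  simp only [intervalIntegral.integral_const_mul] at hint
  rw [integral_add_cont (by fun_prop) (by fun_prop), integral_add_cont (by fun_prop) (by fun_prop),
    integral_add_cont (by fun_prop) (by fun_prop), integral_add_cont (by fun_prop) (by fun_prop),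
    integral_add_cont (by fun_prop) (by fun_prop)] at hint
  simpa only [intervalIntegral.integral_const_mul] using hint

section Cubes

variable {lam ρ A a b : ℝ} {u : ℕ → ℝ → ℝ} {N : ℕ}

/-- The energy identity bounds the signed flux by A / 2. By the lower bound, passing to absolute
values costs at most twice the dissipation of mode n, hence at most A more. -/
lemma integral_flux_le (hu : Sol lam ρ u) (hA : EnergyLe lam u A)
    (ha : 0 ≤ a) (hab : a ≤ b)
    (hlow : ∀ n, N ≤ n → ∀ t ∈ Icc a b, -lam ^ (2 * n) ≤ ρ ^ (n + 1) * u (n + 1) t)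
    {n : ℕ} (hn : N ≤ n) :
    ∫ t in a..b, ρ ^ (n + 1) * u n t ^ 2 * |u (n + 1) t| ≤ 3 / 2 * A := by
  have c1 := hu.cont n
  have c2 := hu.cont (n + 1)
  have h1 : ∫ t in a..b, ρ ^ (n + 1) * u n t ^ 2 * |u (n + 1) t| ≤
      ∫ t in a..b, (ρ ^ (n + 1) * u n t ^ 2 * u (n + 1) t + 2 * (lam ^ (2 * n) * u n t ^ 2)) := by
    refine integral_mono_Icc hab (by fun_prop) (by fun_prop) fun t ht => ?_
    have h := mul_abs_le_of_lower (hlow n hn t ht)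
      ((even_two_mul n).pow_nonneg lam)
    have := mul_le_mul_of_nonneg_right h (sq_nonneg (u n t))
    linarith
  rw [integral_add_cont (by fun_prop) (by fun_prop), intervalIntegral.integral_const_mul] at h1
  have h2 := hu.energy_identity n ha hab
  have h3 : 0 ≤ ∑ m ∈ range (n + 1), u m b ^ 2 := Finset.sum_nonneg fun _ _ => sq_nonneg _
  have h4 : 0 ≤ ∑ m ∈ range (n + 1), diss lam u m a b :=
    Finset.sum_nonneg fun _ _ => diss_nonneg lam u _ hab
  have h5 := hA.sum_sq_le (n + 1) ha
  have h6 := hA.diss_le hu.cont n ha hab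
  unfold diss at h6
  linarith

/-- The cubes `ρ ^ n * |u n| ^ 3` are integrable uniformly in `n`. -/
lemma exists_integral_cube_le (hlam : 1 < lam) (hρ : 0 < ρ) (hu : Sol lam ρ u)
    (hA : EnergyLe lam u A) (ha : 0 ≤ a) (hab : a ≤ b)
    (hlow : ∀ n, N ≤ n → ∀ t ∈ Icc a b, -lam ^ (2 * n) ≤ ρ ^ (n + 1) * u (n + 1) t) :
    ∃ C, ∀ n, N + 1 ≤ n → ∫ t in a..b, ρ ^ n * |u n t| ^ 3 ≤ C := by
  set G : ℕ → ℝ := fun n => ∫ t in a..b, ρ ^ n * |u n t| ^ 3 with hG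
  have hA0 := hA.nonneg
  -- The first bound absorbs the cube of mode n itself into the left side; the other two give the
  -- smallness that `le_two_mul_of_recursive_bound` needs for η = 1 / (ρ m).
  obtain ⟨m, hm1, hm2, hm3⟩ : ∃ m : ℝ, ρ ≤ m ∧ 4 / ρ ≤ m ∧ 2 * (1 + ρ) ≤ m :=
    ⟨max ρ (max (4 / ρ) (2 * (1 + ρ))), le_max_left _ _, (le_max_left _ _).trans (le_max_right _ _),
      (le_max_right _ _).trans (le_max_right _ _)⟩
  have hm : 0 < m := hρ.trans_le hm1
  set c := lam ^ 2 / ρ + 1 + lam ^ 2 + 2 * ρ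
  set C := 2 * A + c * (3 / 2 * A) + m / 2 * (3 * A)
  have hc : 0 ≤ c := by positivity
  have hL : 1 ≤ lam ^ 2 := one_le_pow₀ hlam.le
  have hgrow : ∀ n, G n ≤ ((b - a) * √A ^ 3) * ρ ^ n := by
    intro n
    have c1 := hu.cont n
    have : G n ≤ ∫ t in a..b, ρ ^ n * √A ^ 3 := by
      refine integral_mono_Icc hab (by fun_prop) (by fun_prop) fun t ht => ?_
      have := hA.abs_le n (ha.trans ht.1)
      gcongr
    rw [intervalIntegral.integral_const, smul_eq_mul] at this
    linarith
  have hrec : ∀ n, N + 1 ≤ n → G n ≤ 2 / ρ * C + 1 / (ρ * m) * (G (n + 1) + G (n + 2)) := by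
    intro n hn
    obtain ⟨n, rfl⟩ : ∃ k, n = k + 1 := ⟨n - 1, by omega⟩
    have hnN : N ≤ n := by omega
    have c0 := hu.cont n
    have c1 := hu.cont (n + 1)
    have c2 := hu.cont (n + 2)
    have c3 := hu.cont (n + 3)
    have v1 := continuous_vf (lam := lam) (ρ := ρ) hu.cont (n + 1)
    have v2 := continuous_vf (lam := lam) (ρ := ρ) hu.cont (n + 2)
    -- The derivative of u_(n+1) u_(n+2): it contains the cube ρ^(n+2) u_(n+1)³, while its integral
    -- is controlled by endpoint energies.
    set q : ℝ → ℝ := fun t => vf lam ρ (fun m => u m t) (n + 1) * u (n + 2) t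
      + u (n + 1) t * vf lam ρ (fun m => u m t) (n + 2) with hq
    have cq : Continuous q := by fun_prop
    have hqi : ∫ t in a..b, q t ≤ 2 * A := by
      rw [integral_eq_of_right_deriv hab (c1.fun_mul c2) cq fun t ht =>
        (hu.deriv (n + 1) t (ha.trans ht)).fun_mul (hu.deriv (n + 2) t (ha.trans ht))]
      have i1 := hA.sq_le (n + 1) ha
      have i2 := hA.sq_le (n + 2) ha
      have i3 := hA.sq_le (n + 1) (ha.trans hab)
      have i4 := hA.sq_le (n + 2) (ha.trans hab)
      nlinarith [sq_nonneg (u (n + 1) b - u (n + 2) b), sq_nonneg (u (n + 1) a + u (n + 2) a)]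
    have hpt : ∀ t ∈ Icc a b, ρ * (ρ ^ (n + 1) * |u (n + 1) t| ^ 3) ≤
        q t + c * (lam ^ (2 * n) * u n t ^ 2 + (lam ^ (2 * (n + 1)) * u (n + 1) t ^ 2
          + lam ^ (2 * (n + 2)) * u (n + 2) t ^ 2))
        + m / 2 * (ρ ^ (n + 2) * u (n + 1) t ^ 2 * |u (n + 2) t|
          + ρ ^ (n + 3) * u (n + 2) t ^ 2 * |u (n + 3) t|)
        + 1 / (2 * m) * (ρ ^ (n + 2) * |u (n + 2) t| ^ 3 + (ρ ^ 2 * (ρ ^ (n + 1) * |u (n + 1) t| ^ 3)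
          + ρ ^ (n + 3) * |u (n + 3) t| ^ 3)) := by
      intro t ht
      have := cube_le (ρ := ρ) (K := ρ ^ (n + 1)) (D := lam ^ (2 * n)) (L := lam ^ 2) (m := m)
        (p := u n t) (x := u (n + 1) t) (y := u (n + 2) t) (z := u (n + 3) t) (q := q t)
        hρ (by positivity) (by positivity) hL hm (hlow n hnN t ht) (by
          have := hlow (n + 1) (by omega) t ht
          calc _ = -lam ^ (2 * (n + 1)) := by ring
            _ ≤ _ := this
            _ = _ := by ring) (by
          simp only [hq, vf, Nat.add_sub_cancel, show n + 2 - 1 = n + 1 from rfl]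
          ring)
      refine this.trans (le_of_eq ?_)
      ring
    have hint := integral_le_of_pointwise hab (q := q)
      (d₀ := fun t => lam ^ (2 * n) * u n t ^ 2)
      (d₁ := fun t => lam ^ (2 * (n + 1)) * u (n + 1) t ^ 2)
      (d₂ := fun t => lam ^ (2 * (n + 2)) * u (n + 2) t ^ 2)
      (f₁ := fun t => ρ ^ (n + 2) * u (n + 1) t ^ 2 * |u (n + 2) t|)
      (f₂ := fun t => ρ ^ (n + 3) * u (n + 2) t ^ 2 * |u (n + 3) t|)
      (g₁ := fun t => ρ ^ (n + 1) * |u (n + 1) t| ^ 3)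
      (g₂ := fun t => ρ ^ (n + 2) * |u (n + 2) t| ^ 3)
      (g₃ := fun t => ρ ^ (n + 3) * |u (n + 3) t| ^ 3)
      (by fun_prop) (by fun_prop) (by fun_prop) (by fun_prop) (by fun_prop) (by fun_prop)
      (by fun_prop) (by fun_prop) (by fun_prop) hpt
    have f1 := integral_flux_le hu hA ha hab hlow (n := n + 1) (by omega)
    have f2 := integral_flux_le hu hA ha hab hlow (n := n + 2) (by omega)
    have d0 := hA.diss_le hu.cont n ha hab
    have d1 := hA.diss_le hu.cont (n + 1) ha hab
    have d2 := hA.diss_le hu.cont (n + 2) ha hab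
    unfold diss at d0 d1 d2
    have hG1 : 0 ≤ G (n + 1) :=
      intervalIntegral.integral_nonneg hab fun t _ => by positivity
    change ρ * G (n + 1) ≤ (∫ t in a..b, q t) + _ + _ +
      1 / (2 * m) * (G (n + 2) + (ρ ^ 2 * G (n + 1) + G (n + 3))) at hint
    have s1 := mul_le_mul_of_nonneg_left (add_le_add d0 (add_le_add d1 d2)) hc
    have s2 := mul_le_mul_of_nonneg_left (add_le_add f1 f2) (by positivity : 0 ≤ m / 2)
    have s3 : 1 / (2 * m) * (ρ ^ 2 * G (n + 1)) ≤ ρ / 2 * G (n + 1) := by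
      rw [← mul_assoc]
      gcongr
      rw [div_mul_eq_mul_div, div_le_div_iff₀ (by positivity) two_pos]
      nlinarith
    have s4 : ρ / 2 * G (n + 1) ≤ C + 1 / (2 * m) * (G (n + 2) + G (n + 3)) := by
      simp only [C]
      linarith
    calc G (n + 1) = 2 / ρ * (ρ / 2 * G (n + 1)) := by field_simp
      _ ≤ 2 / ρ * (C + 1 / (2 * m) * (G (n + 2) + G (n + 3))) := by gcongr
      _ = _ := by field_simp
  refine ⟨2 * (2 / ρ * C), fun n hn => ?_⟩
  refine le_two_mul_of_recursive_bound (ρ := ρ) (η := 1 / (ρ * m)) hρ.le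
    (mul_nonneg (by linarith) (by positivity)) (by positivity) (by positivity) ?_ ?_ hgrow hrec hn
  · rw [div_le_div_iff₀ (by positivity) (by norm_num)]
    have := mul_le_mul_of_nonneg_left hm2 hρ.le
    rw [mul_div_cancel₀ _ hρ.ne'] at this
    linarith
  · rw [div_mul_eq_mul_div, div_le_div_iff₀ (by positivity) (by norm_num)]
    have := mul_le_mul_of_nonneg_left hm3 hρ.le
    nlinarith

end Cubes

end DyadicModel

/-! ### Uniqueness from a lower bound on the high modes. -/

namespace DyadicModel

open Finset (range)

/-- Grönwall's inequality with an integrable forcing and zero initial value. -/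
lemma le_exp_mul_integral {f f' g : ℝ → ℝ} {a b K : ℝ} (hab : a ≤ b) (hK : 0 ≤ K)
    (hf : Continuous f) (hg : Continuous g) (hg0 : ∀ t, 0 ≤ g t) (hfa : f a = 0)
    (h : ∀ t ∈ Ico a b, HasDerivWithinAt f (f' t) (Ici t) t)
    (hle : ∀ t ∈ Ico a b, f' t ≤ K * f t + g t) :
    f b ≤ Real.exp (K * (b - a)) * ∫ t in a..b, g t := by
  have hd : ∀ t ∈ Ico a b, HasDerivWithinAt (fun t => Real.exp (-(K * (t - a))) * f t)
      (Real.exp (-(K * (t - a))) * (f' t - K * f t)) (Ici t) t := by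
    intro t ht
    have h1 : HasDerivWithinAt (fun t => -(K * (t - a))) (-(K * 1)) (Ici t) t :=
      (((hasDerivWithinAt_id t _).sub_const a).const_mul K).neg
    refine (h1.exp.fun_mul (h t ht)).congr_deriv ?_
    ring
  have h2 := sub_le_integral_of_right_deriv hab (by fun_prop) hg hd fun t ht => by
    have e1 : Real.exp (-(K * (t - a))) ≤ 1 :=
      Real.exp_le_one_iff.2 (neg_nonpos.2 (mul_nonneg hK (sub_nonneg.2 ht.1)))
    have e2 : f' t - K * f t ≤ g t := by linarith [hle t ht]
    exact (mul_le_mul_of_nonneg_left e2 (Real.exp_nonneg _)).trans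
      (mul_le_of_le_one_left (hg0 t) e1)
  rw [hfa, mul_zero, sub_zero] at h2
  calc f b = Real.exp (K * (b - a)) * (Real.exp (-(K * (b - a))) * f b) := by
        rw [← mul_assoc, ← Real.exp_add]; simp
    _ ≤ _ := by gcongr

/-- Put d = x - y. The product d_n d_(n+1) enters the equation of mode n + 1 with twice the
coefficient it has, with opposite sign, in that of mode n. The weight 2^(-n) is exactly what cancels
the two. -/
lemma weighted_difference_algebra (lam ρ : ℝ) (x y : ℕ → ℝ) (hx : x 0 = 0) (hy : y 0 = 0) (M : ℕ) :
    ∑ n ∈ range (M + 1), (1 / 2 : ℝ) ^ n * (2 * (x n - y n) * (vf lam ρ x n - vf lam ρ y n)) =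
      ∑ n ∈ range (M + 1),
        -(2 * lam ^ (2 * n) + ρ ^ (n + 1) * (x (n + 1) + y (n + 1)))
          * ((1 / 2 : ℝ) ^ n * (x n - y n) ^ 2)
      - (1 / 2 : ℝ) ^ M * ρ ^ (M + 1) * ((x M ^ 2 - y M ^ 2) * (x (M + 1) - y (M + 1))) := by
  induction M with
  | zero => simp [hx, hy]
  | succ M ih =>
    rw [Finset.sum_range_succ, ih, Finset.sum_range_succ _ (M + 1)]
    simp only [vf, Nat.add_sub_cancel]
    ring

lemma neg_boundary_le_cubes (x y z w : ℝ) :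
    -((x ^ 2 - y ^ 2) * (z - w)) ≤ 2 * (|x| ^ 3 + |y| ^ 3 + |z| ^ 3 + |w| ^ 3) := by
  have h1 : -((x ^ 2 - y ^ 2) * (z - w)) ≤ (|x| ^ 2 + |y| ^ 2) * (|z| + |w|) := by
    rw [sq_abs, sq_abs]
    refine (neg_le_abs _).trans ?_
    rw [abs_mul]
    refine mul_le_mul ?_ (abs_sub z w) (abs_nonneg _) (by positivity)
    rw [abs_le]
    constructor <;> nlinarith [sq_nonneg x, sq_nonneg y]
  have a1 := sq_mul_le_cubes (abs_nonneg x) (abs_nonneg z)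
  have a2 := sq_mul_le_cubes (abs_nonneg x) (abs_nonneg w)
  have a3 := sq_mul_le_cubes (abs_nonneg y) (abs_nonneg z)
  have a4 := sq_mul_le_cubes (abs_nonneg y) (abs_nonneg w)
  linarith

variable {lam ρ A a b : ℝ} {u v : ℕ → ℝ → ℝ} {N : ℕ}

/-- Two solutions that agree at time `a` and whose negative parts are small in the high modes
coincide. -/
theorem eq_of_lower_bound (hlam : 1 < lam) (hρ : 0 < ρ) (hu : Sol lam ρ u) (hv : Sol lam ρ v)
    (hAu : EnergyLe lam u A) (hAv : EnergyLe lam v A) (ha : 0 ≤ a) (hab : a ≤ b)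
    (hinit : ∀ n, u n a = v n a)
    (hlu : ∀ n, N ≤ n → ∀ t ∈ Icc a b, -lam ^ (2 * n) ≤ ρ ^ (n + 1) * u (n + 1) t)
    (hlv : ∀ n, N ≤ n → ∀ t ∈ Icc a b, -lam ^ (2 * n) ≤ ρ ^ (n + 1) * v (n + 1) t) (n : ℕ) :
    u n b = v n b := by
  obtain ⟨Cu, hCu⟩ := exists_integral_cube_le hlam hρ hu hAu ha hab hlu
  obtain ⟨Cv, hCv⟩ := exists_integral_cube_le hlam hρ hv hAv ha hab hlv
  have hA0 := hAu.nonneg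
  set K := 2 * (1 + ρ) ^ N * √A with hK
  set ψ : ℕ → ℝ → ℝ := fun M t => ∑ n ∈ range (M + 1), (1 / 2 : ℝ) ^ n * (u n t - v n t) ^ 2
    with hψ
  have hbound : ∀ M, N + 1 ≤ M → ψ M b ≤
      Real.exp (K * (b - a)) * ((1 / 2 : ℝ) ^ M * (2 * ((1 + ρ) * (Cu + Cv)))) := by
    intro M hM
    have cu0 := hu.cont M
    have cu1 := hu.cont (M + 1)
    have cv0 := hv.cont M
    have cv1 := hv.cont (M + 1)
    set g : ℝ → ℝ := fun t => (1 / 2 : ℝ) ^ M * (2 * (ρ * (ρ ^ M * |u M t| ^ 3)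
      + (ρ * (ρ ^ M * |v M t| ^ 3) + (ρ ^ (M + 1) * |u (M + 1) t| ^ 3
        + ρ ^ (M + 1) * |v (M + 1) t| ^ 3)))) with hg
    have hgc : Continuous g := by fun_prop
    have key := le_exp_mul_integral (f := ψ M) (g := g) (K := K)
      (f' := fun t => ∑ n ∈ range (M + 1), (1 / 2 : ℝ) ^ n * (2 * (u n t - v n t) *
        (vf lam ρ (fun m => u m t) n - vf lam ρ (fun m => v m t) n))) hab (by positivity)
      (continuous_finsetSum _ fun n _ => by
        have := hu.cont n
        have := hv.cont n
        fun_prop) hgc (fun t => by positivity) (by simp [hψ, hinit])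
      (fun t ht => hasDerivWithinAt_sum_sq (x := fun n t => u n t - v n t)
        (x' := fun n t => vf lam ρ (fun m => u m t) n - vf lam ρ (fun m => v m t) n) _ _ _
        fun n _ => (hu.deriv n t (ha.trans ht.1)).fun_sub (hv.deriv n t (ha.trans ht.1)))
      (fun t ht => by
        rw [weighted_difference_algebra lam ρ (fun m => u m t) (fun m => v m t) (hu.zero t)
          (hv.zero t), hψ, Finset.mul_sum, sub_eq_add_neg]
        refine add_le_add (Finset.sum_le_sum fun n hn => ?_) ?_
        · refine mul_le_mul_of_nonneg_right ?_ (by positivity)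
          have hl : 0 ≤ lam ^ (2 * n) := by positivity
          have htI : t ∈ Icc a b := ⟨ht.1, ht.2.le⟩
          -- For n ≥ N the lower bounds on u and v add up to make the coefficient at most 0; for the
          -- finitely many other n it is at most K.
          rcases le_or_gt N n with h | h
          · have h1 := hlu n h t htI
            have h2 := hlv n h t htI
            have : 0 ≤ K := by positivity
            linarith
          · have h1 := neg_abs_le (u (n + 1) t)
            have h2 := neg_abs_le (v (n + 1) t)
            have h3 := hAu.abs_le (n + 1) (ha.trans ht.1)
            have h4 := hAv.abs_le (n + 1) (ha.trans ht.1)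
            have h5 : ρ ^ (n + 1) ≤ (1 + ρ) ^ N :=
              (pow_le_pow_left₀ hρ.le (by linarith) _).trans
                (pow_le_pow_right₀ (by linarith) (by omega))
            have h6 : ρ ^ (n + 1) * (-(u (n + 1) t) - v (n + 1) t) ≤ (1 + ρ) ^ N * (2 * √A) :=
              (mul_le_mul_of_nonneg_left (by linarith) (by positivity)).trans
                (mul_le_mul_of_nonneg_right h5 (by positivity))
            linarith
        · have h1 := mul_le_mul_of_nonneg_left
            (neg_boundary_le_cubes (u M t) (v M t) (u (M + 1) t) (v (M + 1) t))
            (by positivity : 0 ≤ (1 / 2 : ℝ) ^ M * ρ ^ (M + 1))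
          calc _ = (1 / 2 : ℝ) ^ M * ρ ^ (M + 1) *
                -((u M t ^ 2 - v M t ^ 2) * (u (M + 1) t - v (M + 1) t)) := by ring
            _ ≤ _ := h1
            _ = _ := by simp only [hg]; ring)
    refine key.trans (mul_le_mul_of_nonneg_left ?_ (Real.exp_nonneg _))
    have e : ∫ t in a..b, g t = (1 / 2 : ℝ) ^ M * (2 * (ρ * (∫ t in a..b, ρ ^ M * |u M t| ^ 3)
      + (ρ * (∫ t in a..b, ρ ^ M * |v M t| ^ 3) + ((∫ t in a..b, ρ ^ (M + 1) * |u (M + 1) t| ^ 3)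
        + ∫ t in a..b, ρ ^ (M + 1) * |v (M + 1) t| ^ 3)))) := by
      rw [← integral_add_cont (by fun_prop) (by fun_prop), ← intervalIntegral.integral_const_mul ρ,
        ← intervalIntegral.integral_const_mul ρ, ← integral_add_cont (by fun_prop) (by fun_prop),
        ← integral_add_cont (by fun_prop) (by fun_prop), ← intervalIntegral.integral_const_mul,
        ← intervalIntegral.integral_const_mul]
    rw [e]
    have g1 := hCu M hM
    have g2 := hCv M hM
    have g3 := hCu (M + 1) (by omega)
    have g4 := hCv (M + 1) (by omega)
    gcongr
    have := mul_le_mul_of_nonneg_left g1 hρ.le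
    have := mul_le_mul_of_nonneg_left g2 hρ.le
    linarith
  have hlim : Tendsto (fun M : ℕ => Real.exp (K * (b - a)) *
      ((1 / 2 : ℝ) ^ M * (2 * ((1 + ρ) * (Cu + Cv))))) atTop (𝓝 0) := by
    have := ((tendsto_pow_atTop_nhds_zero_of_lt_one (r := (1 / 2 : ℝ)) (by norm_num)
      (by norm_num)).mul_const (2 * ((1 + ρ) * (Cu + Cv)))).const_mul (Real.exp (K * (b - a)))
    simpa using this
  have h0 : (1 / 2 : ℝ) ^ n * (u n b - v n b) ^ 2 ≤ 0 := by
    refine ge_of_tendsto hlim ?_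
    filter_upwards [eventually_ge_atTop (max (N + 1) n)] with M hM
    refine le_trans ?_ (hbound M ((le_max_left _ _).trans hM))
    exact Finset.single_le_sum (f := fun n => (1 / 2 : ℝ) ^ n * (u n b - v n b) ^ 2)
      (fun _ _ => by positivity)
      (Finset.mem_range.2 (Nat.lt_succ_of_le ((le_max_right _ _).trans hM)))
  have h1 : (u n b - v n b) ^ 2 ≤ 0 := nonpos_of_mul_nonpos_right h0 (by positivity)
  have h2 := pow_eq_zero_iff (two_ne_zero) |>.1 (le_antisymm h1 (sq_nonneg _))
  linarith

end DyadicModel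

/-! ### Control of negative modes by the energy above them. -/

namespace DyadicModel

open Finset (range)

section LowerBounds

variable {lam ρ A : ℝ} {u v : ℕ → ℝ → ℝ}

/-- A mode that is nonnegative at some time stays nonnegative. -/
lemma nonneg_of_nonneg (hρ : 0 < ρ) (hu : Sol lam ρ u) (hA : EnergyLe lam u A) {n : ℕ} {s t : ℝ}
    (hs : 0 ≤ s) (hst : s ≤ t) (h : 0 ≤ u n s) : 0 ≤ u n t := by
  -- The extra 1 makes the barrier δ exp(K(t - s)) grow strictly faster than -u_n wherever they
  -- touch.
  set K := ρ ^ (n + 1) * √A + 1 with hK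
  have hbar : ∀ δ > 0, -u n t ≤ δ * Real.exp (K * (t - s)) := by
    intro δ hδ
    refine image_le_of_deriv_right_lt_deriv_boundary' (f := fun t => -u n t)
      (f' := fun t => -vf lam ρ (fun m => u m t) n) (B := fun x => δ * Real.exp (K * (x - s)))
      (B' := fun x => δ * (Real.exp (K * (x - s)) * K)) (hu.cont n).neg.continuousOn
      (fun x hx => (hu.deriv n x (hs.trans hx.1)).neg) (by simp; linarith)
      (by fun_prop) (fun x hx => ?_) (fun x hx hxe => ?_) (right_mem_Icc.2 hst)
    · have h1 : HasDerivWithinAt (fun t => K * (t - s)) (K * 1) (Ici x) x :=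
        ((hasDerivWithinAt_id x _).sub_const s).const_mul K
      simpa using h1.exp.const_mul δ
    · have hE : 0 < δ * Real.exp (K * (x - s)) := by positivity
      have h1 := neg_abs_le (u (n + 1) x)
      have h2 := hA.abs_le (n + 1) (hs.trans hx.1)
      have h3 : 0 ≤ ρ ^ n * u (n - 1) x ^ 2 := by positivity
      have h4 : 0 ≤ lam ^ (2 * n) * (δ * Real.exp (K * (x - s))) :=
        mul_nonneg ((even_two_mul n).pow_nonneg lam) hE.le
      have h5 : u n x = -(δ * Real.exp (K * (x - s))) := by linarith
      have h6 : ρ ^ (n + 1) * (δ * Real.exp (K * (x - s))) * -u (n + 1) x ≤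
          ρ ^ (n + 1) * (δ * Real.exp (K * (x - s))) * √A :=
        mul_le_mul_of_nonneg_left (by linarith) (by positivity)
      simp only [vf, h5, hK] at *
      linarith
  have hlim : Tendsto (fun δ : ℝ => δ * Real.exp (K * (t - s))) (𝓝[>] 0) (𝓝 0) := by
    have : Tendsto (fun δ : ℝ => δ * Real.exp (K * (t - s))) (𝓝 0)
        (𝓝 (0 * Real.exp (K * (t - s)))) := tendsto_id.mul_const _
    rw [zero_mul] at this
    exact this.mono_left nhdsWithin_le_nhds
  have := ge_of_tendsto hlim (eventually_nhdsWithin_of_forall hbar)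
  linarith

/-- A negative mode is controlled by the energy of the higher modes at any earlier time. -/
lemma sq_le_of_neg (hρ : 0 < ρ) (hu : Sol lam ρ u) (hA : EnergyLe lam u A) {n : ℕ} {s t : ℝ}
    (hs : 0 ≤ s) (hst : s ≤ t) (h : u n t < 0) (M : ℕ) :
    u n t ^ 2 ≤ A - ∑ m ∈ range n, u m s ^ 2 - 2 * ∑ m ∈ range M, diss lam u m 0 s := by
  obtain ⟨k, rfl⟩ : ∃ k, n = k + 1 := by
    refine ⟨n - 1, ?_⟩
    rcases n with _ | n
    · exact absurd h (by rw [hu.zero]; exact lt_irrefl _)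
    · rfl
  have hneg : ∀ r ∈ Icc s t, u (k + 1) r ≤ 0 := fun r hr => by
    by_contra! hr'
    exact absurd (nonneg_of_nonneg hρ hu hA (hs.trans hr.1) hr.2 hr'.le) (not_le.2 h)
  have hflux : ∫ r in s..t, ρ ^ (k + 1) * u k r ^ 2 * u (k + 1) r ≤ 0 := by
    have c1 := hu.cont k
    have c2 := hu.cont (k + 1)
    have := integral_mono_Icc (f := fun r => ρ ^ (k + 1) * u k r ^ 2 * u (k + 1) r)
      (g := fun _ => 0) hst (by fun_prop) (by fun_prop)
      fun r hr => mul_nonpos_of_nonneg_of_nonpos (by positivity) (hneg r hr)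
    simpa using this
  have hid := hu.energy_identity k hs hst
  -- The truncated energy inequality has to contain mode k + 1 itself and the dissipation of the
  -- first M modes.
  set M' := max M (k + 2)
  have hE := hA M' t (hs.trans hst)
  rw [Finset.sum_add_distrib, ← Finset.mul_sum] at hE
  have e1 : ∑ m ∈ range (k + 1), u m t ^ 2 + u (k + 1) t ^ 2 ≤ ∑ m ∈ range M', u m t ^ 2 := by
    rw [← Finset.sum_range_succ]
    exact Finset.sum_le_sum_of_subset_of_nonneg (Finset.range_mono (le_max_right _ _))
      fun _ _ _ => sq_nonneg _
  have e2 : ∑ m ∈ range M', diss lam u m 0 t =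
      ∑ m ∈ range M', diss lam u m 0 s + ∑ m ∈ range M', diss lam u m s t := by
    rw [← Finset.sum_add_distrib]
    exact Finset.sum_congr rfl fun m _ => (diss_add lam hu.cont m 0 s t).symm
  have e3 : ∑ m ∈ range M, diss lam u m 0 s ≤ ∑ m ∈ range M', diss lam u m 0 s :=
    Finset.sum_le_sum_of_subset_of_nonneg (Finset.range_mono (le_max_left _ _))
      fun _ _ _ => diss_nonneg lam u _ hs
  have e4 : ∑ m ∈ range (k + 1), diss lam u m s t ≤ ∑ m ∈ range M', diss lam u m s t :=
    Finset.sum_le_sum_of_subset_of_nonneg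
      (Finset.range_mono ((Nat.le_succ _).trans (le_max_right _ _)))
      fun _ _ _ => diss_nonneg lam u _ hst
  linarith

/-- Smallness of the energy of the high modes of `u` at time `s`, relative to the energy
bound `A`. -/
def TailSmall (lam ρ : ℝ) (u : ℕ → ℝ → ℝ) (A s : ℝ) : Prop :=
  ∃ N, ∀ n, N ≤ n → ∃ M, ρ ^ (2 * (n + 1)) *
    (A - ∑ m ∈ range (n + 1), u m s ^ 2 - 2 * ∑ m ∈ range M, diss lam u m 0 s) ≤ lam ^ (4 * n)

lemma TailSmall.congr {s : ℝ} (hs : 0 ≤ s) (h : TailSmall lam ρ u A s)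
    (huv : ∀ n, ∀ t ∈ Icc 0 s, u n t = v n t) : TailSmall lam ρ v A s := by
  have e1 : ∀ m, diss lam v m 0 s = diss lam u m 0 s := fun m => by
    refine intervalIntegral.integral_congr fun t ht => ?_
    rw [uIcc_of_le hs] at ht
    simp only [huv m t ht]
  have e2 : ∀ m, v m s = u m s := fun m => (huv m s (right_mem_Icc.2 hs)).symm
  unfold TailSmall
  simp only [e1, e2]
  exact h

lemma TailSmall.lower_bound (hρ : 0 < ρ) (hu : Sol lam ρ u) (hA : EnergyLe lam u A) {s : ℝ}
    (hs : 0 ≤ s) (h : TailSmall lam ρ u A s) :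
    ∃ N, ∀ n, N ≤ n → ∀ t, s ≤ t → -lam ^ (2 * n) ≤ ρ ^ (n + 1) * u (n + 1) t := by
  obtain ⟨N, hN⟩ := h
  refine ⟨N, fun n hn t ht => ?_⟩
  have hl : 0 ≤ lam ^ (2 * n) := (even_two_mul n).pow_nonneg lam
  rcases le_or_gt 0 (u (n + 1) t) with h | h
  · have : 0 ≤ ρ ^ (n + 1) * u (n + 1) t := by positivity
    linarith
  · obtain ⟨M, hM⟩ := hN n hn
    have h1 := mul_le_mul_of_nonneg_left (sq_le_of_neg hρ hu hA hs ht h M)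
      (by positivity : 0 ≤ ρ ^ (2 * (n + 1)))
    refine (abs_le_of_sq_le_sq' (a := ρ ^ (n + 1) * u (n + 1) t) ?_ hl).1
    calc _ = ρ ^ (2 * (n + 1)) * u (n + 1) t ^ 2 := by ring
      _ ≤ lam ^ (4 * n) := h1.trans hM
      _ = _ := by ring

/-- Uniqueness after a time at which the high modes are small. -/
theorem eq_of_tailSmall (hlam : 1 < lam) (hρ : 0 < ρ) (hu : Sol lam ρ u) (hv : Sol lam ρ v)
    (hAu : EnergyLe lam u A) (hAv : EnergyLe lam v A) {s : ℝ} (hs : 0 ≤ s)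
    (huv : ∀ n, ∀ t ∈ Icc 0 s, u n t = v n t) (h : TailSmall lam ρ u A s) (n : ℕ) {t : ℝ}
    (ht : 0 ≤ t) : u n t = v n t := by
  rcases le_total t s with hts | hts
  · exact huv n t ⟨ht, hts⟩
  obtain ⟨N₁, h₁⟩ := h.lower_bound hρ hu hAu hs
  obtain ⟨N₂, h₂⟩ := (h.congr hs huv).lower_bound hρ hv hAv hs
  exact eq_of_lower_bound (N := max N₁ N₂) hlam hρ hu hv hAu hAv hs hts
    (fun n => huv n s (right_mem_Icc.2 hs))
    (fun n hn t ht => h₁ n ((le_max_left _ _).trans hn) t ht.1)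
    (fun n hn t ht => h₂ n ((le_max_right _ _).trans hn) t ht.1) n

/-- The case β ≤ 2: a tail of the initial energy below λ^(-4) suffices, and tails tend to 0. -/
lemma tailSmall_zero (hlam : 1 < lam) (hρ : 0 < ρ) (hρlam : ρ ≤ lam ^ 2)
    (hA : Tendsto (fun M => ∑ m ∈ range M, u m 0 ^ 2) atTop (𝓝 A)) : TailSmall lam ρ u A 0 := by
  have h1 : Tendsto (fun n => A - ∑ m ∈ range (n + 1), u m 0 ^ 2) atTop (𝓝 (A - A)) :=
    ((tendsto_add_atTop_iff_nat 1).2 hA).const_sub A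
  rw [sub_self] at h1
  have hpos : 0 < (lam ^ 4)⁻¹ := by positivity
  obtain ⟨N, hN⟩ := eventually_atTop.1 (h1.eventually_le_const hpos)
  refine ⟨N, fun n hn => ⟨0, ?_⟩⟩
  rw [Finset.range_zero, Finset.sum_empty, mul_zero, sub_zero]
  calc _ ≤ ρ ^ (2 * (n + 1)) * (lam ^ 4)⁻¹ := mul_le_mul_of_nonneg_left (hN n hn) (by positivity)
    _ ≤ (lam ^ 2) ^ (2 * (n + 1)) * (lam ^ 4)⁻¹ := by gcongr
    _ = lam ^ (4 * n) := by
      field_simp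
      ring

end LowerBounds

/-! ### Smoothing of small high modes and the tail at a positive time. -/

section Smoothing

variable {lam ρ θ A : ℝ} {u : ℕ → ℝ → ℝ}

/-- The scale θ^n is critical: since ρθ = λ², nonlinearity and dissipation scale alike there, and
the smallness of B leaves a factor κ. -/
lemma nonlinearity_le {B κ p x y : ℝ} (hρ : 0 < ρ) (hθ : 0 < θ) (hρθ : ρ * θ = lam ^ 2)
    (hB : 0 ≤ B) (hκ : B * (lam ^ 2 * θ ^ 2 + 1) ≤ κ * θ ^ 2) {k : ℕ} (hp : |p| ≤ B * θ ^ k)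
    (hx : |x| ≤ B * θ ^ (k + 1)) (hy : |y| ≤ B * θ ^ (k + 2)) :
    ρ ^ (k + 1) * p ^ 2 + ρ ^ (k + 2) * (|x| * |y|) ≤
      lam ^ (2 * (k + 1)) * (κ * B * θ ^ (k + 1)) := by
  rw [pow_mul, ← hρθ, ← sq_abs p]
  rw [← hρθ] at hκ
  calc ρ ^ (k + 1) * |p| ^ 2 + ρ ^ (k + 2) * (|x| * |y|)
      ≤ ρ ^ (k + 1) * (B * θ ^ k) ^ 2
        + ρ ^ (k + 2) * ((B * θ ^ (k + 1)) * (B * θ ^ (k + 2))) := by gcongr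
    _ = ρ ^ (k + 1) * θ ^ (2 * k) * B * (B * (ρ * θ * θ ^ 2 + 1)) := by ring
    _ ≤ ρ ^ (k + 1) * θ ^ (2 * k) * B * (κ * θ ^ 2) := by gcongr
    _ = _ := by ring

/-- One step of the smoothing iteration. -/
lemma smoothing_step {a b c B κ : ℝ} {N : ℕ} (hlam : 1 < lam) (hρ : 0 < ρ) (hθ : 0 < θ)
    (hρθ : ρ * θ = lam ^ 2) (hu : Sol lam ρ u) (hB : 0 < B) (hκ0 : κ < 1)
    (hκ : B * (lam ^ 2 * θ ^ 2 + 1) ≤ κ * θ ^ 2) (ha : 0 ≤ a) (hac : a < c)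
    (h : ∀ n, N ≤ n → ∀ t ∈ Icc a b, |u n t| ≤ B * θ ^ n) :
    ∃ N', ∀ n, N' ≤ n → ∀ t ∈ Icc c b, |u n t| ≤ (κ + 2) / 3 * B * θ ^ n := by
  -- The sign σ treats both bounds on u at once. The level (2κ + 1)/3 lies strictly above κ when κ <
  -- 1, and the exponential covers the data at time a. Once it is below (1 - κ)/3, the sum is at
  -- most (κ + 2)/3.
  have hbar : ∀ σ : ℝ, |σ| = 1 → ∀ k, N ≤ k → ∀ t ∈ Icc a b, σ * u (k + 1) t ≤
      B * θ ^ (k + 1) * ((2 * κ + 1) / 3 + Real.exp (-(lam ^ (2 * (k + 1)) * (t - a)))) := by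
    intro σ hσ k hk t ht
    have hκ' : 0 < κ := by
      have : 0 < B * (lam ^ 2 * θ ^ 2 + 1) := by positivity
      exact pos_of_mul_pos_left (this.trans_le hκ) (by positivity)
    have hBθ : 0 < B * θ ^ (k + 1) := by positivity
    have hD : 0 < lam ^ (2 * (k + 1)) := by positivity
    refine image_le_of_deriv_right_lt_deriv_boundary' (f := fun t => σ * u (k + 1) t)
      (f' := fun t => σ * vf lam ρ (fun m => u m t) (k + 1))
      (B := fun t => B * θ ^ (k + 1) *
        ((2 * κ + 1) / 3 + Real.exp (-(lam ^ (2 * (k + 1)) * (t - a)))))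
      (B' := fun t => B * θ ^ (k + 1) *
        (Real.exp (-(lam ^ (2 * (k + 1)) * (t - a))) * -(lam ^ (2 * (k + 1)) * 1)))
      ((hu.cont _).const_mul σ).continuousOn
      (fun x hx => (hu.deriv (k + 1) x (ha.trans hx.1)).const_mul σ) ?_ (by fun_prop)
      (fun x hx => ?_) (fun x hx hxe => ?_) ht
    · have h1 := h (k + 1) (by omega) a (left_mem_Icc.2 (ht.1.trans ht.2))
      have h2 : σ * u (k + 1) a ≤ |u (k + 1) a| := by
        have := le_abs_self (σ * u (k + 1) a)
        rwa [abs_mul, hσ, one_mul] at this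
      refine (h2.trans h1).trans (le_mul_of_one_le_right hBθ.le ?_)
      simp
      positivity
    · have h1 : HasDerivWithinAt (fun t => -(lam ^ (2 * (k + 1)) * (t - a)))
          (-(lam ^ (2 * (k + 1)) * 1)) (Ici x) x :=
        (((hasDerivWithinAt_id x _).sub_const a).const_mul _).neg
      exact (h1.exp.const_add _).const_mul _
    · have hxI : x ∈ Icc a b := ⟨hx.1, hx.2.le⟩
      have h1 := nonlinearity_le hρ hθ hρθ hB.le hκ (h k hk x hxI) (h (k + 1) (by omega) x hxI)
        (h (k + 2) (by omega) x hxI)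
      have h2 : σ * (ρ ^ (k + 1) * u k x ^ 2) ≤ ρ ^ (k + 1) * u k x ^ 2 :=
        mul_le_of_le_one_left (by positivity) (hσ ▸ le_abs_self σ)
      have h3 : -(σ * (ρ ^ (k + 2) * u (k + 1) x * u (k + 2) x)) ≤
          ρ ^ (k + 2) * (|u (k + 1) x| * |u (k + 2) x|) := by
        refine (neg_le_abs _).trans (le_of_eq ?_)
        rw [abs_mul, hσ, abs_mul, abs_mul, abs_of_pos (by positivity : 0 < ρ ^ (k + 2))]
        ring
      have h4 : lam ^ (2 * (k + 1)) * (κ * B * θ ^ (k + 1)) <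
          lam ^ (2 * (k + 1)) * ((2 * κ + 1) / 3 * B * θ ^ (k + 1)) := by
        have : κ < (2 * κ + 1) / 3 := by linarith
        gcongr
      have h5 : σ * vf lam ρ (fun m => u m x) (k + 1) = -(lam ^ (2 * (k + 1)) * (σ * u (k + 1) x))
          + σ * (ρ ^ (k + 1) * u k x ^ 2)
          - σ * (ρ ^ (k + 2) * u (k + 1) x * u (k + 2) x) := by
        simp only [vf, Nat.add_sub_cancel]
        ring
      rw [h5, hxe]
      linarith
  have hlim : Tendsto (fun n : ℕ => Real.exp (-(lam ^ (2 * n) * (c - a)))) atTop (𝓝 0) := by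
    refine Real.tendsto_exp_neg_atTop_nhds_zero.comp (Tendsto.atTop_mul_const (sub_pos.2 hac) ?_)
    simp_rw [pow_mul]
    exact tendsto_pow_atTop_atTop_of_one_lt (one_lt_pow₀ hlam two_ne_zero)
  obtain ⟨N₁, hN₁⟩ := eventually_atTop.1
    (hlim.eventually_le_const (by linarith : (0 : ℝ) < (1 - κ) / 3))
  refine ⟨max N₁ (N + 1), fun n hn t ht => ?_⟩
  obtain ⟨k, rfl⟩ : ∃ k, n = k + 1 :=
    ⟨n - 1, by have := (le_max_right N₁ (N + 1)).trans hn; omega⟩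
  have hk : N ≤ k := by have := (le_max_right N₁ (N + 1)).trans hn; omega
  have htI : t ∈ Icc a b := ⟨hac.le.trans ht.1, ht.2⟩
  have hexp : Real.exp (-(lam ^ (2 * (k + 1)) * (t - a))) ≤ (1 - κ) / 3 := by
    refine le_trans (Real.exp_le_exp.2 ?_) (hN₁ (k + 1) ((le_max_left _ _).trans hn))
    have : c - a ≤ t - a := by linarith [ht.1]
    gcongr
  have hmain : B * θ ^ (k + 1) * ((2 * κ + 1) / 3
      + Real.exp (-(lam ^ (2 * (k + 1)) * (t - a)))) ≤ (κ + 2) / 3 * B * θ ^ (k + 1) := by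
    have : (2 * κ + 1) / 3 + Real.exp (-(lam ^ (2 * (k + 1)) * (t - a))) ≤ (κ + 2) / 3 := by
      linarith
    calc _ ≤ B * θ ^ (k + 1) * ((κ + 2) / 3) := by gcongr
      _ = _ := by ring
  have p1 := hbar 1 (by simp) k hk t htI
  have p2 := hbar (-1) (by simp) k hk t htI
  rw [abs_le]
  constructor <;> linarith

/-- Small high modes decay faster than `θ ^ n` at positive times. -/
lemma smoothing {T B κ : ℝ} {N : ℕ} (hlam : 1 < lam) (hρ : 0 < ρ) (hθ : 0 < θ)
    (hρθ : ρ * θ = lam ^ 2) (hu : Sol lam ρ u) (hB : 0 < B) (hκ0 : κ < 1)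
    (hκ : B * (lam ^ 2 * θ ^ 2 + 1) ≤ κ * θ ^ 2) (hT : 0 < T)
    (h : ∀ n, N ≤ n → ∀ t ∈ Icc 0 T, |u n t| ≤ B * θ ^ n) {δ : ℝ} (hδ : 0 < δ) :
    ∃ N', ∀ n, N' ≤ n → |u n T| ≤ δ * θ ^ n := by
  have hκ' : 0 < κ := by
    have : 0 < B * (lam ^ 2 * θ ^ 2 + 1) := by positivity
    exact pos_of_mul_pos_left (this.trans_le hκ) (by positivity)
  -- To reach time c, the first j steps are spent by c / 2. The same κ serves every step because the
  -- constant only decreases.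
  have key : ∀ j : ℕ, ∀ c ∈ Ioc 0 T, ∃ N', ∀ n, N' ≤ n → ∀ t ∈ Icc c T,
      |u n t| ≤ ((κ + 2) / 3) ^ j * B * θ ^ n := by
    intro j
    induction j with
    | zero => exact fun c hc => ⟨N, fun n hn t ht => by
        simpa using h n hn t ⟨hc.1.le.trans ht.1, ht.2⟩⟩
    | succ j ih =>
      intro c hc
      obtain ⟨N₁, h₁⟩ := ih (c / 2) ⟨half_pos hc.1, (half_le_self hc.1.le).trans hc.2⟩
      have hle : ((κ + 2) / 3) ^ j ≤ 1 := pow_le_one₀ (by positivity) (by linarith)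
      obtain ⟨N₂, h₂⟩ := smoothing_step (κ := κ) hlam hρ hθ hρθ hu
        (by positivity : 0 < ((κ + 2) / 3) ^ j * B) hκ0
        (by
          refine le_trans ?_ hκ
          have : ((κ + 2) / 3) ^ j * B ≤ B := mul_le_of_le_one_left hB.le hle
          gcongr)
        (half_pos hc.1).le (half_lt_self hc.1) h₁
      refine ⟨N₂, fun n hn t ht => (h₂ n hn t ht).trans (le_of_eq ?_)⟩
      ring
  have hlim : Tendsto (fun j : ℕ => ((κ + 2) / 3) ^ j * B) atTop (𝓝 (0 * B)) :=
    (tendsto_pow_atTop_nhds_zero_of_lt_one (by positivity) (by linarith)).mul_const B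
  rw [zero_mul] at hlim
  obtain ⟨j, hj⟩ := (hlim.eventually_le_const hδ).exists
  obtain ⟨N', hN'⟩ := key j T ⟨hT, le_rfl⟩
  refine ⟨N', fun n hn => (hN' n hn T ⟨le_rfl, le_rfl⟩).trans ?_⟩
  gcongr

/-- The bound on u_(n+1) makes the flux at most Bλ² times the dissipation of mode n, which is
summable. No energy is lost at infinity. -/
lemma tendsto_flux {T B : ℝ} {N : ℕ} (hρ : 0 < ρ) (hρθ : ρ * θ = lam ^ 2) (hu : Sol lam ρ u)
    (hA : EnergyLe lam u A) (hT : 0 ≤ T)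
    (h : ∀ n, N ≤ n → ∀ t ∈ Icc 0 T, |u n t| ≤ B * θ ^ n) :
    Tendsto (fun n => ∫ t in (0 : ℝ)..T, ρ ^ (n + 1) * u n t ^ 2 * u (n + 1) t) atTop (𝓝 0) := by
  have hlim := (hA.tendsto_diss hu.cont le_rfl hT).const_mul (B * lam ^ 2)
  rw [mul_zero] at hlim
  refine squeeze_zero_norm' ?_ hlim
  filter_upwards [eventually_ge_atTop N] with n hn
  have c1 := hu.cont n
  have c2 := hu.cont (n + 1)
  unfold diss
  rw [← intervalIntegral.integral_const_mul]
  refine abs_integral_le hT (by fun_prop) (by fun_prop) fun t ht => ?_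
  rw [abs_mul, abs_of_nonneg (by positivity : 0 ≤ ρ ^ (n + 1) * u n t ^ 2)]
  calc _ ≤ ρ ^ (n + 1) * u n t ^ 2 * (B * θ ^ (n + 1)) :=
        mul_le_mul_of_nonneg_left (h (n + 1) (by omega) t ht) (by positivity)
    _ = B * (ρ * θ) ^ (n + 1) * u n t ^ 2 := by ring
    _ = _ := by rw [hρθ]; ring

lemma tailSmall_of_small {T B κ : ℝ} {N : ℕ} (hlam : 1 < lam) (hρ : 0 < ρ) (hθ : 0 < θ)
    (hθ1 : θ < 1) (hρθ : ρ * θ = lam ^ 2) (hu : Sol lam ρ u) (hA : EnergyLe lam u A)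
    (hAlim : Tendsto (fun M => ∑ m ∈ range M, u m 0 ^ 2) atTop (𝓝 A))
    (hB : 0 < B) (hκ0 : κ < 1)
    (hκ : B * (lam ^ 2 * θ ^ 2 + 1) ≤ κ * θ ^ 2) (hT : 0 < T)
    (h : ∀ n, N ≤ n → ∀ t ∈ Icc 0 T, |u n t| ≤ B * θ ^ n) : TailSmall lam ρ u A T := by
  have hθ2 : 0 < 1 - θ ^ 2 := sub_pos.2 (pow_lt_one₀ hθ.le hθ1 two_ne_zero)
  -- Chosen so that the geometric tail of δ² θ^(2m) from n + 1 on is θ^(2(n+1)) / (2λ⁴), half of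
  -- what `TailSmall` allows. The other half pays for the truncation at M.
  set δ := √((1 - θ ^ 2) / (2 * lam ^ 4)) with hδ
  have hδ0 : 0 < δ := by positivity
  have hδ2 : δ ^ 2 = (1 - θ ^ 2) / (2 * lam ^ 4) := Real.sq_sqrt (by positivity)
  obtain ⟨N', hN'⟩ := smoothing hlam hρ hθ hρθ hu hB hκ0 hκ hT h hδ0
  refine ⟨N', fun n hn => ?_⟩
  have hlim : Tendsto (fun M => A - ∑ m ∈ range (M + 1), u m 0 ^ 2
      + 2 * ∫ t in (0 : ℝ)..T, ρ ^ (M + 1) * u M t ^ 2 * u (M + 1) t) atTop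
      (𝓝 (A - A + 2 * 0)) :=
    (((tendsto_add_atTop_iff_nat 1).2 hAlim).const_sub A).add
      ((tendsto_flux hρ hρθ hu hA hT.le h).const_mul 2)
  rw [sub_self, mul_zero, add_zero] at hlim
  have hpos : 0 < θ ^ (2 * (n + 1)) / (2 * lam ^ 4) := by positivity
  obtain ⟨M, hM1, hM2⟩ := ((hlim.eventually_le_const hpos).and (eventually_ge_atTop n)).exists
  refine ⟨M + 1, ?_⟩
  have hid := hu.energy_identity M le_rfl hT.le
  have hsplit : ∑ m ∈ range (M + 1), u m T ^ 2 ≤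
      ∑ m ∈ range (n + 1), u m T ^ 2 + θ ^ (2 * (n + 1)) / (2 * lam ^ 4) := by
    obtain ⟨j, rfl⟩ := Nat.exists_eq_add_of_le hM2
    rw [show n + j + 1 = (n + 1) + j by ring, Finset.sum_range_add]
    have h1 : ∑ i ∈ range j, u (n + 1 + i) T ^ 2 ≤
        ∑ i ∈ range j, δ ^ 2 * θ ^ (2 * (n + 1)) * (θ ^ 2) ^ i := by
      refine Finset.sum_le_sum fun i _ => ?_
      have := hN' (n + 1 + i) (by omega)
      rw [← sq_abs]
      calc |u (n + 1 + i) T| ^ 2 ≤ (δ * θ ^ (n + 1 + i)) ^ 2 := by gcongr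
        _ = _ := by ring
    rw [← Finset.mul_sum] at h1
    have h2 : ∑ i ∈ range j, (θ ^ 2) ^ i ≤ 1 / (1 - θ ^ 2) := by
      rw [le_div_iff₀ hθ2, ← neg_sub, mul_neg, geom_sum_mul]
      have : 0 ≤ (θ ^ 2) ^ j := by positivity
      linarith
    have h3 : δ ^ 2 * θ ^ (2 * (n + 1)) * ∑ i ∈ range j, (θ ^ 2) ^ i ≤
        θ ^ (2 * (n + 1)) / (2 * lam ^ 4) := by
      refine (mul_le_mul_of_nonneg_left h2 (by positivity)).trans (le_of_eq ?_)
      rw [hδ2]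
      field_simp
    linarith
  calc _ ≤ ρ ^ (2 * (n + 1)) * (θ ^ (2 * (n + 1)) / (2 * lam ^ 4)
        + θ ^ (2 * (n + 1)) / (2 * lam ^ 4)) := by
        refine mul_le_mul_of_nonneg_left ?_ (by positivity)
        linarith
    _ = (ρ * θ) ^ (2 * (n + 1)) / lam ^ 4 := by
        rw [mul_pow]
        field_simp
        ring
    _ = lam ^ (4 * n) := by
        rw [hρθ]
        field_simp
        ring

end Smoothing

end DyadicModel

/-! ### Weak-strong uniqueness. -/

namespace DyadicModel

open Finset (range)

/-- Apart from the boundary, the interaction is quadratic in x - y with coefficients from x alone,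
so smallness of one solution is enough. -/
lemma cross_energy_algebra (lam ρ : ℝ) (x y : ℕ → ℝ) (hx : x 0 = 0) (hy : y 0 = 0) (M : ℕ) :
    ∑ n ∈ range (M + 1), (vf lam ρ x n * y n + x n * vf lam ρ y n) =
      -2 * ∑ n ∈ range (M + 1), lam ^ (2 * n) * (x n * y n)
      + ∑ n ∈ range M, ρ ^ (n + 1) *
          ((x n - y n) * (x (n + 1) * (x n - y n) - x n * (x (n + 1) - y (n + 1))))
      - ρ ^ (M + 1) * (x M * y M * (x (M + 1) + y (M + 1))) := by
  induction M with
  | zero => simp [hx, hy]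
  | succ M ih =>
    rw [Finset.sum_range_succ, ih, Finset.sum_range_succ _ (M + 1),
      Finset.sum_range_succ (fun n => ρ ^ (n + 1) *
        ((x n - y n) * (x (n + 1) * (x n - y n) - x n * (x (n + 1) - y (n + 1))))) M]
    simp only [vf, Nat.add_sub_cancel]
    ring

section

variable {lam ρ θ A B T : ℝ} {u v : ℕ → ℝ → ℝ} {N : ℕ}

/-- The bound on u_n turns ρ^(n+1) |u_n| into at most Bρλ^(2n); the other two factors are paid for
by dissipation, which tends to 0. -/
lemma tendsto_cross_boundary (hρ : 0 < ρ) (hρθ : ρ * θ = lam ^ 2) (hlam : 1 < lam)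
    (hu : Sol lam ρ u) (hv : Sol lam ρ v) (hAu : EnergyLe lam u A) (hAv : EnergyLe lam v A)
    (hT : 0 ≤ T) (hB : 0 ≤ B) (h : ∀ n, N ≤ n → ∀ t ∈ Icc 0 T, |u n t| ≤ B * θ ^ n) :
    Tendsto (fun n => ∫ t in (0 : ℝ)..T, ρ ^ (n + 1) * (u n t * v n t * (u (n + 1) t + v (n + 1) t)))
      atTop (𝓝 0) := by
  have h1 := hAv.tendsto_diss hv.cont le_rfl hT
  have h2 := (tendsto_add_atTop_iff_nat 1).2 (hAu.tendsto_diss hu.cont le_rfl hT)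
  have h3 := (tendsto_add_atTop_iff_nat 1).2 h1
  have hlim := (h1.add (h2.add h3)).const_mul (B * ρ)
  rw [add_zero, add_zero, mul_zero] at hlim
  refine squeeze_zero_norm' ?_ hlim
  filter_upwards [eventually_ge_atTop N] with n hn
  have c1 := hu.cont n
  have c2 := hu.cont (n + 1)
  have c3 := hv.cont n
  have c4 := hv.cont (n + 1)
  unfold diss
  rw [← integral_add_cont (by fun_prop) (by fun_prop),
    ← integral_add_cont (by fun_prop) (by fun_prop), ← intervalIntegral.integral_const_mul]
  refine abs_integral_le hT (by fun_prop) (by fun_prop) fun t ht => ?_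
  have hBθ : 0 ≤ B * θ ^ n := (abs_nonneg _).trans (h n hn t ht)
  have hD : lam ^ (2 * n) ≤ lam ^ (2 * (n + 1)) := pow_le_pow_right₀ hlam.le (by omega)
  have e1 : |v n t| * (|u (n + 1) t| + |v (n + 1) t|) ≤
      v n t ^ 2 + (u (n + 1) t ^ 2 + v (n + 1) t ^ 2) := by
    rw [← sq_abs (v n t), ← sq_abs (u (n + 1) t), ← sq_abs (v (n + 1) t)]
    nlinarith [sq_nonneg (|v n t| - |u (n + 1) t|), sq_nonneg (|v n t| - |v (n + 1) t|),
      sq_nonneg (|u (n + 1) t|), sq_nonneg (|v (n + 1) t|)]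
  rw [abs_mul, abs_mul, abs_mul, abs_of_pos (by positivity : 0 < ρ ^ (n + 1))]
  calc _ ≤ ρ ^ (n + 1) * (B * θ ^ n * |v n t| * (|u (n + 1) t| + |v (n + 1) t|)) := by
        gcongr
        · exact h n hn t ht
        · exact abs_add_le _ _
    _ = B * ρ * (ρ * θ) ^ n * (|v n t| * (|u (n + 1) t| + |v (n + 1) t|)) := by ring
    _ = B * ρ * (lam ^ (2 * n) * (|v n t| * (|u (n + 1) t| + |v (n + 1) t|))) := by
        rw [hρθ]; ring
    _ ≤ B * ρ * (lam ^ (2 * n) * (v n t ^ 2 + (u (n + 1) t ^ 2 + v (n + 1) t ^ 2))) := by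
        gcongr
    _ ≤ B * ρ * (lam ^ (2 * n) * v n t ^ 2 + (lam ^ (2 * (n + 1)) * u (n + 1) t ^ 2
          + lam ^ (2 * (n + 1)) * v (n + 1) t ^ 2)) := by
        rw [mul_add, mul_add (lam ^ (2 * n))]
        gcongr

/-- Young's inequality is weighted by λ to match the ratio λ² of consecutive dissipation rates; this
is the source of ρ/λ = λ^(β-1) in ε. -/
lemma high_interaction_le {x w p q : ℝ} {n : ℕ} (hlam : 1 < lam) (hρ : 0 < ρ)
    (hρθ : ρ * θ = lam ^ 2) (hB : 0 ≤ B) (hx : |x| ≤ B * θ ^ n) (hw : |w| ≤ B * θ ^ (n + 1)) :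
    -(2 * (ρ ^ (n + 1) * (p * (w * p - x * q)))) ≤
      B * (2 * lam ^ 2 + ρ / lam) * (lam ^ (2 * n) * p ^ 2)
        + B * (ρ / lam) * (lam ^ (2 * (n + 1)) * q ^ 2) := by
  have e0 : -(p * (w * p - x * q)) ≤ B * θ ^ (n + 1) * p ^ 2 + B * θ ^ n * (|p| * |q|) := by
    have h1 : -w * p ^ 2 ≤ B * θ ^ (n + 1) * p ^ 2 :=
      mul_le_mul_of_nonneg_right ((neg_le_abs w).trans hw) (sq_nonneg p)
    have h2 : x * (p * q) ≤ B * θ ^ n * (|p| * |q|) := by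
      rw [← abs_mul]
      exact (le_abs_self _).trans ((abs_mul x (p * q)).le.trans
        (mul_le_mul_of_nonneg_right hx (abs_nonneg _)))
    linarith
  have e1 : 2 * (|p| * |q|) * lam ≤ p ^ 2 + lam ^ 2 * q ^ 2 := by
    rw [← sq_abs p, ← sq_abs q]
    nlinarith [sq_nonneg (|p| - lam * |q|)]
  have e2 : 2 * (|p| * |q|) ≤ (p ^ 2 + lam ^ 2 * q ^ 2) / lam := by
    rwa [le_div_iff₀ (by linarith)]
  calc _ = 2 * (ρ ^ (n + 1) * -(p * (w * p - x * q))) := by ring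
    _ ≤ 2 * (ρ ^ (n + 1) * (B * θ ^ (n + 1) * p ^ 2 + B * θ ^ n * (|p| * |q|))) := by gcongr
    _ = 2 * B * (ρ * θ) ^ (n + 1) * p ^ 2 + B * ρ * (ρ * θ) ^ n * (2 * (|p| * |q|)) := by ring
    _ = 2 * B * lam ^ 2 * lam ^ (2 * n) * p ^ 2 + B * ρ * lam ^ (2 * n) * (2 * (|p| * |q|)) := by
        rw [hρθ]; ring
    _ ≤ 2 * B * lam ^ 2 * lam ^ (2 * n) * p ^ 2
        + B * ρ * lam ^ (2 * n) * ((p ^ 2 + lam ^ 2 * q ^ 2) / lam) := by gcongr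
    _ = _ := by field_simp; ring

lemma low_interaction_le {x w p q a : ℝ} {n : ℕ} (hρ : 0 < ρ) (hn : n < N)
    (hx : |x| ≤ a) (hw : |w| ≤ a) :
    -(2 * (ρ ^ (n + 1) * (p * (w * p - x * q)))) ≤ (1 + ρ) ^ N * a * (3 * p ^ 2 + q ^ 2) := by
  have ha : 0 ≤ a := (abs_nonneg x).trans hx
  have e0 : -(2 * (p * (w * p - x * q))) ≤ a * (3 * p ^ 2 + q ^ 2) := by
    have h1 : -w * p ^ 2 ≤ a * p ^ 2 :=
      mul_le_mul_of_nonneg_right ((neg_le_abs w).trans hw) (sq_nonneg p)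
    have h2 : x * (p * q) ≤ a * (|p| * |q|) := by
      rw [← abs_mul]
      exact (le_abs_self _).trans ((abs_mul x (p * q)).le.trans
        (mul_le_mul_of_nonneg_right hx (abs_nonneg _)))
    have h3 : 2 * (|p| * |q|) ≤ p ^ 2 + q ^ 2 := by
      rw [← sq_abs p, ← sq_abs q]
      nlinarith [sq_nonneg (|p| - |q|)]
    have := mul_le_mul_of_nonneg_left h3 ha
    linarith
  have h5 : ρ ^ (n + 1) ≤ (1 + ρ) ^ N :=
    (pow_le_pow_left₀ hρ.le (by linarith) _).trans (pow_le_pow_right₀ (by linarith) (by omega))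
  calc _ = ρ ^ (n + 1) * -(2 * (p * (w * p - x * q))) := by ring
    _ ≤ ρ ^ (n + 1) * (a * (3 * p ^ 2 + q ^ 2)) := by gcongr
    _ ≤ (1 + ρ) ^ N * (a * (3 * p ^ 2 + q ^ 2)) := by gcongr
    _ = _ := by ring

/-- Interactions from mode N on total at most 2B(λ² + ρ/λ) ≤ 2 times the dissipation of w. The
finitely many others leave a term for Grönwall. -/
lemma interaction_sum_le {x w : ℕ → ℝ} {a : ℝ} (hlam : 1 < lam) (hρ : 0 < ρ)
    (hρθ : ρ * θ = lam ^ 2) (hB : 0 ≤ B) (hB1 : B * (lam ^ 2 + ρ / lam) ≤ 1)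
    (hx : ∀ n, |x n| ≤ a) (hxN : ∀ n, N ≤ n → |x n| ≤ B * θ ^ n) {M : ℕ} (hM : N ≤ M) :
    -(2 * ∑ n ∈ range M, ρ ^ (n + 1) * (w n * (x (n + 1) * w n - x n * w (n + 1)))) ≤
      2 * ∑ n ∈ range (M + 1), lam ^ (2 * n) * w n ^ 2
        + (1 + ρ) ^ N * a * 4 * ∑ n ∈ range (N + 1), w n ^ 2 := by
  have ha : 0 ≤ a := (abs_nonneg _).trans (hx 0)
  obtain ⟨j, rfl⟩ := Nat.exists_eq_add_of_le hM
  set e : ℕ → ℝ := fun n => lam ^ (2 * n) * w n ^ 2 with he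
  have he0 : ∀ n, 0 ≤ e n := fun n => mul_nonneg ((even_two_mul n).pow_nonneg lam) (sq_nonneg _)
  have hlow : ∑ n ∈ range N, -(2 * (ρ ^ (n + 1) * (w n * (x (n + 1) * w n - x n * w (n + 1))))) ≤
      (1 + ρ) ^ N * a * 4 * ∑ n ∈ range (N + 1), w n ^ 2 := by
    have h1 : ∑ n ∈ range N, w n ^ 2 ≤ ∑ n ∈ range (N + 1), w n ^ 2 := by
      rw [Finset.sum_range_succ]; exact le_add_of_nonneg_right (sq_nonneg _)
    have h2 : ∑ n ∈ range N, w (n + 1) ^ 2 ≤ ∑ n ∈ range (N + 1), w n ^ 2 := by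
      rw [Finset.sum_range_succ']; exact le_add_of_nonneg_right (sq_nonneg _)
    calc _ ≤ ∑ n ∈ range N, (1 + ρ) ^ N * a * (3 * w n ^ 2 + w (n + 1) ^ 2) :=
          Finset.sum_le_sum fun n hn =>
            low_interaction_le hρ (Finset.mem_range.1 hn) (hx n) (hx (n + 1))
      _ = (1 + ρ) ^ N * a * (3 * ∑ n ∈ range N, w n ^ 2 + ∑ n ∈ range N, w (n + 1) ^ 2) := by
          rw [← Finset.mul_sum, Finset.sum_add_distrib, ← Finset.mul_sum]
      _ ≤ (1 + ρ) ^ N * a * (3 * ∑ n ∈ range (N + 1), w n ^ 2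
            + ∑ n ∈ range (N + 1), w n ^ 2) := by gcongr
      _ = _ := by ring
  have hhigh : ∑ i ∈ range j, -(2 * (ρ ^ (N + i + 1) *
      (w (N + i) * (x (N + i + 1) * w (N + i) - x (N + i) * w (N + i + 1))))) ≤
      2 * ∑ n ∈ range (N + j + 1), e n := by
    have hsub : ∑ i ∈ range (j + 1), e (N + i) ≤ ∑ n ∈ range (N + j + 1), e n := by
      rw [show N + j + 1 = N + (j + 1) by ring, Finset.sum_range_add e N (j + 1)]
      exact le_add_of_nonneg_left (Finset.sum_nonneg fun n _ => he0 n)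
    have h1 : ∑ i ∈ range j, e (N + i) ≤ ∑ n ∈ range (N + j + 1), e n := by
      rw [Finset.sum_range_succ] at hsub
      linarith [he0 (N + j)]
    have h2 : ∑ i ∈ range j, e (N + i + 1) ≤ ∑ n ∈ range (N + j + 1), e n := by
      rw [Finset.sum_range_succ'] at hsub
      have := he0 (N + 0)
      simp only [← add_assoc] at hsub
      linarith
    have hrl : 0 ≤ ρ / lam := by have : 0 < lam := by linarith
                                 positivity
    have hS : 0 ≤ ∑ n ∈ range (N + j + 1), e n := Finset.sum_nonneg fun n _ => he0 n
    calc _ ≤ ∑ i ∈ range j, (B * (2 * lam ^ 2 + ρ / lam) * e (N + i)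
          + B * (ρ / lam) * e (N + i + 1)) :=
          Finset.sum_le_sum fun i _ => high_interaction_le hlam hρ hρθ hB
            (hxN (N + i) (by omega)) (hxN (N + i + 1) (by omega))
      _ = B * (2 * lam ^ 2 + ρ / lam) * ∑ i ∈ range j, e (N + i)
          + B * (ρ / lam) * ∑ i ∈ range j, e (N + i + 1) := by
          rw [Finset.sum_add_distrib, ← Finset.mul_sum, ← Finset.mul_sum]
      _ ≤ B * (2 * lam ^ 2 + ρ / lam) * ∑ n ∈ range (N + j + 1), e n
          + B * (ρ / lam) * ∑ n ∈ range (N + j + 1), e n := by gcongr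
      _ = 2 * (B * (lam ^ 2 + ρ / lam)) * ∑ n ∈ range (N + j + 1), e n := by ring
      _ ≤ 2 * 1 * ∑ n ∈ range (N + j + 1), e n := by gcongr
      _ = _ := by ring
  rw [Finset.mul_sum, ← Finset.sum_neg_distrib, Finset.sum_range_add]
  linarith

/-- Weak-strong uniqueness: a solution whose high modes are small on `[0, T]` coincides there with
every solution with the same data. -/
theorem weak_strong_uniqueness (hlam : 1 < lam) (hρ : 0 < ρ)
    (hρθ : ρ * θ = lam ^ 2) (hu : Sol lam ρ u) (hv : Sol lam ρ v) (hAu : EnergyLe lam u A)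
    (hAv : EnergyLe lam v A) (hinit : ∀ n, u n 0 = v n 0)
    (hAlim : Tendsto (fun M => ∑ m ∈ range M, u m 0 ^ 2) atTop (𝓝 A))
    (hB : 0 ≤ B) (hB1 : B * (lam ^ 2 + ρ / lam) ≤ 1)
    (h : ∀ n, N ≤ n → ∀ t ∈ Icc 0 T, |u n t| ≤ B * θ ^ n) (n : ℕ) {t : ℝ} (ht : t ∈ Icc 0 T) :
    u n t = v n t := by
  set K := (1 + ρ) ^ N * √A * 4
  have hK : 0 ≤ K := by positivity
  set w : ℕ → ℝ → ℝ := fun n t => u n t - v n t with hw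
  have hwc : ∀ n, Continuous (w n) := fun n => (hu.cont n).sub (hv.cont n)
  set H : ℝ → ℝ := fun t => ∑ n ∈ range (N + 1), w n t ^ 2
  have hHc : Continuous H := continuous_finsetSum _ fun n _ => (hwc n).pow 2
  set bd : ℕ → ℝ → ℝ := fun M s =>
    ∫ t in (0 : ℝ)..s, ρ ^ (M + 1) * (u M t * v M t * (u (M + 1) t + v (M + 1) t))
  -- Expand w² = u² + v² - 2uv, with the energy inequality for the squares and the identity for the
  -- product. The dissipation of w cancels the high interactions, and 2(A - ∑ u_n(0)²) is the
  -- initial energy missed by the truncation.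
  have main : ∀ s ∈ Icc 0 T, ∀ M, N ≤ M → ∑ n ∈ range (M + 1), w n s ^ 2 ≤
      2 * (A - ∑ n ∈ range (M + 1), u n 0 ^ 2) + 2 * bd M s + K * ∫ t in (0 : ℝ)..s, H t := by
    intro s hs M hM
    have hd : ∀ t, 0 ≤ t → HasDerivWithinAt (fun t => ∑ n ∈ range (M + 1), u n t * v n t)
        (∑ n ∈ range (M + 1), (vf lam ρ (fun m => u m t) n * v n t
          + u n t * vf lam ρ (fun m => v m t) n)) (Ici t) t := fun t ht =>
      HasDerivWithinAt.fun_sum fun n _ => (hu.deriv n t ht).fun_mul (hv.deriv n t ht)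
    have c0 : Continuous fun t => ∑ n ∈ range (M + 1), u n t * v n t :=
      continuous_finsetSum _ fun n _ => (hu.cont n).mul (hv.cont n)
    have cI : Continuous fun t => ∑ n ∈ range M, ρ ^ (n + 1) *
        (w n t * (u (n + 1) t * w n t - u n t * w (n + 1) t)) :=
      continuous_finsetSum _ fun n _ => by
        have := hwc n
        have := hwc (n + 1)
        have := hu.cont n
        have := hu.cont (n + 1)
        fun_prop
    have cuv : Continuous fun t => ∑ n ∈ range (M + 1), lam ^ (2 * n) * (u n t * v n t) :=
      continuous_finsetSum _ fun n _ => by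
        have := hu.cont n
        have := hv.cont n
        fun_prop
    have cuu : Continuous fun t => ∑ n ∈ range (M + 1), lam ^ (2 * n) * u n t ^ 2 :=
      continuous_finsetSum _ fun n _ => continuous_diss_integrand lam hu.cont n
    have cvv : Continuous fun t => ∑ n ∈ range (M + 1), lam ^ (2 * n) * v n t ^ 2 :=
      continuous_finsetSum _ fun n _ => continuous_diss_integrand lam hv.cont n
    have cww : Continuous fun t => ∑ n ∈ range (M + 1), lam ^ (2 * n) * w n t ^ 2 :=
      continuous_finsetSum _ fun n _ => continuous_diss_integrand lam hwc n
    have cb : Continuous fun t => ρ ^ (M + 1) * (u M t * v M t * (u (M + 1) t + v (M + 1) t)) := by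
      have := hu.cont M
      have := hu.cont (M + 1)
      have := hv.cont M
      have := hv.cont (M + 1)
      fun_prop
    simp_rw [fun t => cross_energy_algebra lam ρ (fun m => u m t) (fun m => v m t) (hu.zero t)
      (hv.zero t) M] at hd
    have hint := integral_eq_of_right_deriv hs.1 c0 (by fun_prop) hd
    rw [integral_sub_cont (by fun_prop) cb, integral_add_cont (by fun_prop) cI,
      intervalIntegral.integral_const_mul] at hint
    have hpt := integral_mono_Icc hs.1 (by fun_prop) (by fun_prop) fun t ht =>
      interaction_sum_le (x := fun n => u n t) (w := fun n => w n t) hlam hρ hρθ hB hB1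
        (fun n => hAu.abs_le n ht.1) (fun n hn => h n hn t ⟨ht.1, ht.2.trans hs.2⟩) hM
    rw [intervalIntegral.integral_neg, intervalIntegral.integral_const_mul,
      integral_add_cont (by fun_prop) (hHc.const_mul K), intervalIntegral.integral_const_mul,
      intervalIntegral.integral_const_mul] at hpt
    have hsumd : ∀ x : ℕ → ℝ → ℝ, (∀ n, Continuous (x n)) →
        ∑ n ∈ range (M + 1), diss lam x n 0 s =
          ∫ t in (0 : ℝ)..s, ∑ n ∈ range (M + 1), lam ^ (2 * n) * x n t ^ 2 := fun x hx =>
      (intervalIntegral.integral_finsetSum fun n _ =>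
        (continuous_diss_integrand lam hx n).intervalIntegrable _ _).symm
    have hexp : ∫ t in (0 : ℝ)..s, ∑ n ∈ range (M + 1), lam ^ (2 * n) * w n t ^ 2 =
        ∑ n ∈ range (M + 1), diss lam u n 0 s + ∑ n ∈ range (M + 1), diss lam v n 0 s
          - 2 * ∫ t in (0 : ℝ)..s, ∑ n ∈ range (M + 1), lam ^ (2 * n) * (u n t * v n t) := by
      have e := integral_sub_cont (a := 0) (b := s)
        (f := fun t => ∑ n ∈ range (M + 1), lam ^ (2 * n) * u n t ^ 2
          + ∑ n ∈ range (M + 1), lam ^ (2 * n) * v n t ^ 2)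
        (g := fun t => 2 * ∑ n ∈ range (M + 1), lam ^ (2 * n) * (u n t * v n t))
        (by fun_prop) (by fun_prop)
      rw [integral_add_cont cuu cvv, intervalIntegral.integral_const_mul] at e
      rw [hsumd u hu.cont, hsumd v hv.cont, ← e]
      refine intervalIntegral.integral_congr fun t _ => ?_
      simp only [hw, Finset.mul_sum, ← Finset.sum_add_distrib, ← Finset.sum_sub_distrib]
      exact Finset.sum_congr rfl fun n _ => by ring
    have hsq : ∑ n ∈ range (M + 1), w n s ^ 2 = ∑ n ∈ range (M + 1), u n s ^ 2
        + ∑ n ∈ range (M + 1), v n s ^ 2 - 2 * ∑ n ∈ range (M + 1), u n s * v n s := by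
      simp only [hw, Finset.mul_sum, ← Finset.sum_add_distrib, ← Finset.sum_sub_distrib]
      exact Finset.sum_congr rfl fun n _ => by ring
    have h00 : ∑ n ∈ range (M + 1), u n 0 * v n 0 = ∑ n ∈ range (M + 1), u n 0 ^ 2 :=
      Finset.sum_congr rfl fun n _ => by rw [← hinit, sq]
    have hE1 := hAu (M + 1) s hs.1
    have hE2 := hAv (M + 1) s hs.1
    rw [Finset.sum_add_distrib, ← Finset.mul_sum] at hE1 hE2
    simp only [bd]
    linarith
  have hlim : ∀ s ∈ Icc 0 T, Tendsto (fun M => 2 * (A - ∑ n ∈ range (M + 1), u n 0 ^ 2)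
      + 2 * bd M s + K * ∫ t in (0 : ℝ)..s, H t) atTop (𝓝 (K * ∫ t in (0 : ℝ)..s, H t)) := by
    intro s hs
    have h1 := (((tendsto_add_atTop_iff_nat 1).2 hAlim).const_sub A).const_mul 2
    have h2 := (tendsto_cross_boundary hρ hρθ hlam hu hv hAu hAv hs.1 hB
      fun n hn t ht => h n hn t ⟨ht.1, ht.2.trans hs.2⟩).const_mul 2
    have := (h1.add h2).add_const (K * ∫ t in (0 : ℝ)..s, H t)
    simpa only [sub_self, mul_zero, zero_add, add_zero] using this
  have hle : ∀ s ∈ Icc 0 T, ∀ m, ∑ n ∈ range (m + 1), w n s ^ 2 ≤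
      K * ∫ t in (0 : ℝ)..s, H t := by
    intro s hs m
    refine ge_of_tendsto (hlim s hs) ?_
    filter_upwards [eventually_ge_atTop (max N m)] with M hM
    refine le_trans ?_ (main s hs M ((le_max_left _ _).trans hM))
    exact Finset.sum_le_sum_of_subset_of_nonneg
      (Finset.range_mono (Nat.succ_le_succ ((le_max_right _ _).trans hM))) fun _ _ _ => sq_nonneg _
  -- Since H ≤ K ∫ H, Grönwall is applied to the primitive of H, which vanishes at 0.
  have hzero : ∫ r in (0 : ℝ)..t, H r ≤ 0 := by
    have := le_exp_mul_integral (f := fun s => ∫ r in (0 : ℝ)..s, H r) (f' := H) (g := fun _ => 0)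
      (K := K) ht.1 hK (intervalIntegral.continuous_primitive (fun _ _ => hHc.intervalIntegrable _ _) 0)
      continuous_const (fun _ => le_rfl) (by simp)
      (fun s _ => (hHc.integral_hasStrictDerivAt 0 s).hasDerivAt.hasDerivWithinAt)
      (fun s hs => by
        have := hle s ⟨hs.1, hs.2.le.trans ht.2⟩ N
        linarith)
    simpa using this
  have h1 := (hle t ht n).trans (mul_nonpos_of_nonneg_of_nonpos hK hzero)
  have h2 : w n t ^ 2 ≤ 0 :=
    (Finset.single_le_sum (f := fun n => w n t ^ 2) (fun _ _ => sq_nonneg _)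
      (Finset.self_mem_range_succ n)).trans h1
  exact sub_eq_zero.1 ((pow_eq_zero_iff two_ne_zero).1 (le_antisymm h2 (sq_nonneg _)))

end

end DyadicModel

/-! ### Galerkin truncations. -/

namespace DyadicModel

open Finset (range)

/-- `U` solves the dyadic system on `[0, T]` with all modes above `M` switched off. -/
structure GalerkinSol (lam ρ : ℝ) (a : ℕ → ℝ) (M : ℕ) (T A : ℝ) (U : ℕ → ℝ → ℝ) : Prop where
  cont : ∀ n, Continuous (U n)
  zero : ∀ t, U 0 t = 0
  above : ∀ n, M < n → ∀ t, U n t = 0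
  initial : ∀ n ≤ M, U n 0 = a n
  deriv : ∀ n ≤ M, ∀ t ∈ Ico 0 T,
    HasDerivWithinAt (U n) (vf lam ρ (fun m => U m t) n) (Ici t) t
  abs_le : ∀ n t, |U n t| ≤ √A
  lip : ∀ n s t, |U n s - U n t| ≤
    (lam ^ (2 * n) * √A + ρ ^ n * A + ρ ^ (n + 1) * A) * |s - t|

lemma abs_vf_le {lam ρ A : ℝ} (hρ : 0 < ρ) (hA : 0 ≤ A) {x : ℕ → ℝ} (hx : ∀ n, |x n| ≤ √A) (n : ℕ) :
    |vf lam ρ x n| ≤ lam ^ (2 * n) * √A + ρ ^ n * A + ρ ^ (n + 1) * A := by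
  have hl : 0 ≤ lam ^ (2 * n) := (even_two_mul n).pow_nonneg lam
  have e1 : |lam ^ (2 * n) * x n| ≤ lam ^ (2 * n) * √A := by
    rw [abs_mul, abs_of_nonneg hl]
    exact mul_le_mul_of_nonneg_left (hx n) hl
  have e2 : |ρ ^ n * x (n - 1) ^ 2| ≤ ρ ^ n * A := by
    rw [abs_of_nonneg (by positivity), ← sq_abs]
    have : |x (n - 1)| ^ 2 ≤ √A ^ 2 := by gcongr; exact hx _
    rw [Real.sq_sqrt hA] at this
    gcongr
  have e3 : |ρ ^ (n + 1) * x n * x (n + 1)| ≤ ρ ^ (n + 1) * A := by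
    rw [mul_assoc, abs_mul, abs_mul, abs_of_pos (by positivity : 0 < ρ ^ (n + 1))]
    have : |x n| * |x (n + 1)| ≤ √A * √A := by gcongr <;> apply hx
    rw [Real.mul_self_sqrt hA] at this
    gcongr
  unfold vf
  refine (abs_sub _ _).trans (add_le_add ((abs_add_le _ _).trans ?_) e3)
  rw [abs_neg]
  exact add_le_add e1 e2

section Existence

variable (M : ℕ)

/-- Extension of a vector by zero to a sequence whose `0`-th term vanishes. -/
noncomputable def extend (x : EuclideanSpace ℝ (Fin (M + 1))) (n : ℕ) : ℝ :=
  if h : n < M + 1 then (if n = 0 then 0 else x ⟨n, h⟩) else 0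

lemma extend_zero (x : EuclideanSpace ℝ (Fin (M + 1))) : extend M x 0 = 0 := by simp [extend]

lemma extend_above (x : EuclideanSpace ℝ (Fin (M + 1))) {n : ℕ} (h : M < n) : extend M x n = 0 := by
  simp [extend, show ¬ n < M + 1 by omega]

lemma extend_of_pos (x : EuclideanSpace ℝ (Fin (M + 1))) {n : ℕ} (h : n < M + 1) (h0 : n ≠ 0) :
    extend M x n = x ⟨n, h⟩ := by
  simp [extend, h, h0]

lemma contDiff_extend (n : ℕ) : ContDiff ℝ ∞ fun x => extend M x n := by
  unfold extend
  split_ifs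
  · exact contDiff_const
  · exact contDiff_euclidean.1 contDiff_id _
  · exact contDiff_const

lemma abs_extend_le (x : EuclideanSpace ℝ (Fin (M + 1))) (n : ℕ) : |extend M x n| ≤ ‖x‖ := by
  unfold extend
  split_ifs
  · simp
  · exact PiLp.norm_apply_le x _
  · simp

/-- The Galerkin vector field. -/
noncomputable def galerkinField (lam ρ : ℝ) (x : EuclideanSpace ℝ (Fin (M + 1))) :
    EuclideanSpace ℝ (Fin (M + 1)) :=
  WithLp.toLp 2 fun i => vf lam ρ (extend M x) i

lemma contDiff_galerkinField (lam ρ : ℝ) : ContDiff ℝ ∞ (galerkinField M lam ρ) := by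
  refine contDiff_euclidean.2 fun i => ?_
  have h1 := contDiff_extend M i
  have h2 := contDiff_extend M (i - 1)
  have h3 := contDiff_extend M (i + 1)
  simp only [galerkinField, vf]
  fun_prop

/-- The outgoing flux vanishes with mode M + 1, so only minus the dissipation remains. -/
lemma inner_galerkinField_nonpos (lam ρ : ℝ) (x : EuclideanSpace ℝ (Fin (M + 1))) :
    inner ℝ x (galerkinField M lam ρ x) ≤ 0 := by
  have h1 : inner ℝ x (galerkinField M lam ρ x) =
      ∑ n ∈ range (M + 1), extend M x n * vf lam ρ (extend M x) n := by
    rw [← Fin.sum_univ_eq_sum_range (fun n => extend M x n * vf lam ρ (extend M x) n), PiLp.inner_apply]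
    refine Finset.sum_congr rfl fun i _ => ?_
    simp only [galerkinField]
    rcases eq_or_ne (i : ℕ) 0 with h | h
    · rw [h]
      simp [vf, extend_zero]
    · rw [extend_of_pos M x i.2 h]
      simp [mul_comm]
  have h2 := energy_algebra lam ρ (extend M x) (extend_zero M x) M
  rw [extend_above M x (Nat.lt_succ_self M), mul_zero, mul_zero, sub_zero] at h2
  simp_rw [mul_assoc (2 : ℝ)] at h2
  rw [← Finset.mul_sum] at h2
  have h3 : 0 ≤ ∑ n ∈ range (M + 1), lam ^ (2 * n) * extend M x n ^ 2 :=
    Finset.sum_nonneg fun n _ => mul_nonneg ((even_two_mul n).pow_nonneg lam) (sq_nonneg _)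
  linarith

/-- A smooth compactly supported vector field has solutions on every interval `[0, T]`. -/
lemma exists_solution_of_hasCompactSupport {E : Type*} [NormedAddCommGroup E] [NormedSpace ℝ E]
    [CompleteSpace E] {F : E → E} (hF : ContDiff ℝ ∞ F) (hc : HasCompactSupport F)
    (x₀ : E) {T : ℝ} (hT : 0 ≤ T) :
    ∃ α : ℝ → E, α 0 = x₀ ∧ ∀ t ∈ Icc 0 T, HasDerivWithinAt α (F (α t)) (Icc 0 T) t := by
  obtain ⟨K, hK⟩ := ContDiff.lipschitzWith_of_hasCompactSupport hc hF (by simp)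
  obtain ⟨C, hC⟩ := hc.exists_bound_of_continuous hF.continuous
  have hpl : IsPicardLindelof (fun _ => F) (⟨0, left_mem_Icc.2 hT⟩ : Icc 0 T) x₀
      (C.toNNReal * T.toNNReal) 0 C.toNNReal K := by
    refine IsPicardLindelof.of_time_independent
      (fun x _ => (hC x).trans (Real.le_coe_toNNReal C)) hK.lipschitzOnWith ?_
    simp [hT]
  exact hpl.exists_eq_forall_mem_Icc_hasDerivWithinAt₀

lemma exists_galerkinSol {lam ρ A T : ℝ} (hlam : 1 < lam) (hρ : 0 < ρ) (a : ℕ → ℝ) (ha0 : a 0 = 0)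
    (hA : ∀ M, ∑ m ∈ range M, a m ^ 2 ≤ A) (hT : 0 ≤ T) :
    ∃ U, GalerkinSol lam ρ a M T A U := by
  have hA0 : 0 ≤ A := by simpa using hA 0
  set x₀ : EuclideanSpace ℝ (Fin (M + 1)) := WithLp.toLp 2 fun i => a i
  have hx₀ : ‖x₀‖ ≤ √A := by
    rw [EuclideanSpace.norm_eq]
    refine Real.sqrt_le_sqrt ?_
    simp only [x₀, Real.norm_eq_abs, sq_abs]
    rw [Fin.sum_univ_eq_sum_range (fun n => a n ^ 2)]
    exact hA _
  -- The cutoff makes the field globally Lipschitz. Being nonnegative, it keeps the norm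
  -- nonincreasing, so the solution stays where χ = 1 and solves the original system.
  let χ : ContDiffBump (0 : EuclideanSpace ℝ (Fin (M + 1))) :=
    ⟨√A + 1, √A + 2, by positivity, by linarith⟩
  obtain ⟨α, hα0, hα⟩ := exists_solution_of_hasCompactSupport
    (F := fun x => χ x • galerkinField M lam ρ x) (χ.contDiff.smul (contDiff_galerkinField M lam ρ))
    χ.hasCompactSupport.smul_right x₀ hT
  -- Freezing the solution outside [0, T] makes continuity, the bound and the Lipschitz estimate
  -- global.
  set γ : ℝ → EuclideanSpace ℝ (Fin (M + 1)) := fun t => α (projIcc 0 T hT t) with hγ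
  have hγα : ∀ t ∈ Icc 0 T, γ t = α t := fun t ht => by simp only [hγ, projIcc_of_mem hT ht]
  have hαc : ContinuousOn α (Icc 0 T) := fun t ht => (hα t ht).continuousWithinAt
  have hγc : Continuous γ :=
    hαc.comp_continuous (continuous_subtype_val.comp continuous_projIcc) fun t => (projIcc 0 T hT t).2
  have hγ' : ∀ t ∈ Icc 0 T,
      HasDerivWithinAt γ (χ (γ t) • galerkinField M lam ρ (γ t)) (Icc 0 T) t := fun t ht => by
    rw [hγα t ht]
    exact (hα t ht).congr hγα (hγα t ht)
  have hIci : ∀ t ∈ Ico 0 T, Icc 0 T ∈ 𝓝[Ici t] t := fun t ht =>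
    Filter.mem_of_superset (Icc_mem_nhdsGE ht.2) (Icc_subset_Icc_left ht.1)
  have hnorm : ∀ t ∈ Icc 0 T, ‖γ t‖ ≤ ‖x₀‖ := by
    intro t ht
    have h1 := sub_le_integral_of_right_deriv (f := fun t => ‖γ t‖ ^ 2) (g := fun _ => 0) ht.1
      (by fun_prop) continuous_const
      (fun s hs => ((hγ' s ⟨hs.1, hs.2.le.trans ht.2⟩).mono_of_mem_nhdsWithin
        (hIci s ⟨hs.1, hs.2.trans_le ht.2⟩)).norm_sq)
      (fun s _ => by
        rw [inner_smul_right]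
        have := mul_nonpos_of_nonneg_of_nonpos (χ.nonneg' (γ s))
          (inner_galerkinField_nonpos M lam ρ (γ s))
        linarith)
    have h2 : γ 0 = x₀ := by rw [hγα 0 (left_mem_Icc.2 hT), hα0]
    rw [h2, intervalIntegral.integral_zero] at h1
    exact le_of_sq_le_sq (by linarith) (norm_nonneg _)
  have hγproj : ∀ t, γ t = γ (projIcc 0 T hT t) := fun t => by
    simp only [hγ, projIcc_val]
  have hnorm' : ∀ t, ‖γ t‖ ≤ √A := fun t => by
    rw [hγproj]
    exact (hnorm _ (projIcc 0 T hT t).2).trans hx₀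
  have hχ : ∀ t, χ (γ t) = 1 := fun t => χ.one_of_mem_closedBall (by
    rw [mem_closedBall_zero_iff]
    exact (hnorm' t).trans (by simp [χ]))
  have habs : ∀ n t, |extend M (γ t) n| ≤ √A := fun n t => (abs_extend_le M _ n).trans (hnorm' t)
  have hd : ∀ n ≤ M, ∀ t ∈ Icc 0 T, HasDerivWithinAt (fun t => extend M (γ t) n)
      (vf lam ρ (extend M (γ t)) n) (Icc 0 T) t := by
    intro n hn t ht
    rcases eq_or_ne n 0 with rfl | h0
    · simp only [extend_zero]
      refine (hasDerivWithinAt_const t (Icc 0 T) (0 : ℝ)).congr_deriv ?_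
      simp [vf, extend_zero]
    · have h1 := hγ' t ht
      rw [hχ, one_smul] at h1
      have h2 := (EuclideanSpace.proj (𝕜 := ℝ) (⟨n, Nat.lt_succ_of_le hn⟩ : Fin (M + 1))).hasFDerivAt
        |>.comp_hasDerivWithinAt t h1
      simp_rw [extend_of_pos M _ (Nat.lt_succ_of_le hn) h0]
      exact h2
  refine ⟨fun n t => extend M (γ t) n, fun n => (contDiff_extend M n).continuous.comp hγc,
    fun t => extend_zero M _, fun n hn t => extend_above M _ hn, fun n hn => ?_,
    fun n hn t ht => (hd n hn t ⟨ht.1, ht.2.le⟩).mono_of_mem_nhdsWithin (hIci t ht), habs, ?_⟩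
  · rw [hγα 0 (left_mem_Icc.2 hT), hα0]
    rcases eq_or_ne n 0 with rfl | h0
    · rw [extend_zero, ha0]
    · rw [extend_of_pos M _ (Nat.lt_succ_of_le hn) h0]
  · intro n s t
    have hL : 0 ≤ lam ^ (2 * n) * √A + ρ ^ n * A + ρ ^ (n + 1) * A := by positivity
    rcases le_or_gt n M with hn | hn
    · rw [hγproj s, hγproj t]
      have h1 := (convex_Icc (0 : ℝ) T).norm_image_sub_le_of_norm_hasDerivWithin_le
        (fun r hr => hd n hn r hr) (fun r _ => abs_vf_le hρ hA0 (fun m => habs m r) n)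
        (projIcc 0 T hT t).2 (projIcc 0 T hT s).2
      refine h1.trans (mul_le_mul_of_nonneg_left ?_ hL)
      exact abs_projIcc_sub_projIcc hT
    · simp only [extend_above M _ hn, sub_self, abs_zero]
      positivity

end Existence

end DyadicModel

/-! ### Compactness, uniform Galerkin bounds and existence. -/

namespace DyadicModel

open Finset (range)

/-- A uniformly bounded and uniformly Lipschitz sequence of functions. -/
def EquiLip (F : ℕ → ℝ → ℝ) : Prop :=
  ∃ C K : ℝ, 0 ≤ C ∧ 0 ≤ K ∧ (∀ i t, |F i t| ≤ C) ∧ ∀ i s t, |F i s - F i t| ≤ K * |s - t|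

namespace EquiLip

variable {F G : ℕ → ℝ → ℝ}

lemma const (c : ℝ) : EquiLip fun _ _ => c :=
  ⟨|c|, 0, abs_nonneg c, le_rfl, fun _ _ => le_rfl, fun _ _ _ => by simp⟩

lemma add (hF : EquiLip F) (hG : EquiLip G) : EquiLip fun i t => F i t + G i t := by
  obtain ⟨C, K, hC, hK, h1, h2⟩ := hF
  obtain ⟨C', K', hC', hK', h1', h2'⟩ := hG
  refine ⟨C + C', K + K', by positivity, by positivity,
    fun i t => (abs_add_le _ _).trans (add_le_add (h1 i t) (h1' i t)), fun i s t => ?_⟩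
  rw [add_sub_add_comm, add_mul]
  exact (abs_add_le _ _).trans (add_le_add (h2 i s t) (h2' i s t))

lemma mul (hF : EquiLip F) (hG : EquiLip G) : EquiLip fun i t => F i t * G i t := by
  obtain ⟨C, K, hC, hK, h1, h2⟩ := hF
  obtain ⟨C', K', hC', hK', h1', h2'⟩ := hG
  refine ⟨C * C', C * K' + K * C', by positivity, by positivity, fun i t => ?_, fun i s t => ?_⟩
  · rw [abs_mul]
    exact mul_le_mul (h1 i t) (h1' i t) (abs_nonneg _) hC
  · have e : F i s * G i s - F i t * G i t = F i s * (G i s - G i t) + (F i s - F i t) * G i t := by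
      ring
    rw [e]
    refine (abs_add_le _ _).trans ?_
    rw [abs_mul, abs_mul]
    calc _ ≤ C * (K' * |s - t|) + K * |s - t| * C' := by
          gcongr
          · exact h1 i s
          · exact h2' i s t
          · exact h2 i s t
          · exact h1' i t
      _ = _ := by ring

lemma continuous_limit (hF : EquiLip F) {f : ℝ → ℝ} {l : Filter ℕ} [l.NeBot]
    (h : ∀ t, Tendsto (fun i => F i t) l (𝓝 (f t))) : Continuous f := by
  obtain ⟨C, K, hC, hK, h1, h2⟩ := hF
  refine (LipschitzWith.of_dist_le_mul (K := ⟨K, hK⟩) fun s t => ?_).continuous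
  simp only [Real.dist_eq]
  exact le_of_tendsto ((h s).sub (h t)).abs (Eventually.of_forall fun i => h2 i s t)

/-- Dominated convergence can fail along a filter that is not countably generated, such as the
ultrafilter used below. Equicontinuity upgrades pointwise to locally uniform convergence instead. -/
lemma tendsto_integral (hF : EquiLip F) {f : ℝ → ℝ} {l : Filter ℕ} [l.NeBot]
    (h : ∀ t, Tendsto (fun i => F i t) l (𝓝 (f t))) {a b : ℝ} (hab : a ≤ b) :
    Tendsto (fun i => ∫ t in a..b, F i t) l (𝓝 (∫ t in a..b, f t)) := by
  have hfc := hF.continuous_limit h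
  obtain ⟨C, K, hC, hK, h1, h2⟩ := hF
  have hlip : ∀ i, LipschitzWith ⟨K, hK⟩ (F i) := fun i =>
    LipschitzWith.of_dist_le_mul fun s t => h2 i s t
  have huni : TendstoUniformlyOn F f l (Icc a b) := by
    have h3 := (EquicontinuousOn.tendsto_uniformOnFun_iff_pi (𝔖 := {s : Set ℝ | IsCompact s})
      (fun K hK => hK) (eq_univ_of_forall fun x => ⟨{x}, isCompact_singleton, mem_singleton x⟩)
      (fun s _ => ((LipschitzWith.uniformEquicontinuous F _ hlip).equicontinuous).equicontinuousOn s)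
      l f).2 (tendsto_pi_nhds.2 h)
    exact UniformOnFun.tendsto_iff_tendstoUniformlyOn.1 h3 _ isCompact_Icc
  rw [Metric.tendsto_nhds]
  intro ε hε
  have hδ : 0 < ε / (2 * (b - a + 1)) := by
    have : 0 < b - a + 1 := by linarith
    positivity
  filter_upwards [Metric.tendstoUniformlyOn_iff.1 huni _ hδ] with i hi
  rw [dist_comm, Real.dist_eq, ← integral_sub_cont hfc (hlip i).continuous]
  have h4 := intervalIntegral.norm_integral_le_of_norm_le_const (a := a) (b := b)
    (f := fun t => f t - F i t) (C := ε / (2 * (b - a + 1))) fun t ht => by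
      rw [uIoc_of_le hab] at ht
      exact (hi t (Ioc_subset_Icc_self ht)).le
  refine lt_of_le_of_lt h4 ?_
  rw [abs_of_nonneg (by linarith), div_mul_eq_mul_div, div_lt_iff₀ (by linarith)]
  nlinarith

end EquiLip

section Bounds

variable {lam ρ A T : ℝ} {a : ℕ → ℝ} {M : ℕ} {U : ℕ → ℝ → ℝ}

lemma GalerkinSol.energy_le (hU : GalerkinSol lam ρ a M T A U)
    (hA : ∀ M, ∑ m ∈ range M, a m ^ 2 ≤ A) {K : ℕ} (hK : K ≤ M) {t : ℝ} (ht : t ∈ Icc 0 T) :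
    ∑ n ∈ range K, (U n t ^ 2 + 2 * diss lam U n 0 t) ≤ A := by
  have h1 := energy_identity (lam := lam) (ρ := ρ) hU.cont hU.zero M ht.1
    fun n hn s hs => hU.deriv n hn s ⟨hs.1, hs.2.trans_le ht.2⟩
  simp only [hU.above (M + 1) (Nat.lt_succ_self M), mul_zero, intervalIntegral.integral_zero,
    add_zero] at h1
  rw [Finset.mul_sum, ← Finset.sum_add_distrib] at h1
  have h2 : ∑ n ∈ range (M + 1), U n 0 ^ 2 = ∑ n ∈ range (M + 1), a n ^ 2 :=
    Finset.sum_congr rfl fun n hn => by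
      rw [hU.initial n (Nat.lt_succ_iff.1 (Finset.mem_range.1 hn))]
  refine le_trans (Finset.sum_le_sum_of_subset_of_nonneg
    (Finset.range_mono (hK.trans (Nat.le_succ M))) fun n _ _ => ?_) ((h1.trans h2).trans_le (hA _))
  have := diss_nonneg lam U n ht.1
  positivity

/-- Induction runs down from the vanishing modes above M: the forcing by the mode below is
nonnegative, so only the lower bound of the next mode is needed, and no restriction on time. -/
lemma GalerkinSol.lower_bound {θ B₀ B : ℝ} {N : ℕ} (hlam : 1 < lam) (hρ : 0 < ρ)
    (hθ : 0 < θ) (hρθ : ρ * θ = lam ^ 2) (hU : GalerkinSol lam ρ a M T A U) (hB : 0 < B)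
    (hB0 : B₀ ≤ B) (hB1 : B * lam ^ 2 < 1) (ha : ∀ n, N ≤ n → |a n| ≤ B₀ * θ ^ n) :
    ∀ n, N ≤ n → ∀ t ∈ Icc 0 T, -(B * θ ^ n) ≤ U n t := by
  have habove : ∀ n, M < n → ∀ t ∈ Icc 0 T, -(B * θ ^ n) ≤ U n t := fun n hn t _ => by
    rw [hU.above n hn]
    have : 0 < B * θ ^ n := by positivity
    linarith
  have key : ∀ j n, N ≤ n → M < n + j → ∀ t ∈ Icc 0 T, -(B * θ ^ n) ≤ U n t := by
    intro j
    induction j with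
    | zero => exact fun n _ hn => habove n hn
    | succ j ih =>
      intro n hN hn t ht
      rcases lt_or_ge M n with h | h
      · exact habove n h t ht
      have hnext := ih (n + 1) (by omega) (by omega)
      have := image_le_of_deriv_right_lt_deriv_boundary' (f := fun t => -U n t)
        (f' := fun t => -vf lam ρ (fun m => U m t) n) (B := fun _ => B * θ ^ n)
        (B' := fun _ => 0) (hU.cont n).neg.continuousOn (fun x hx => (hU.deriv n h x hx).neg)
        (by
          rw [hU.initial n h]
          have : B₀ * θ ^ n ≤ B * θ ^ n := by gcongr
          exact (neg_le_abs _).trans ((ha n hN).trans this))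
        continuousOn_const (fun x _ => hasDerivWithinAt_const _ _ _)
        (fun x hx hxe => by
          have e1 : U n x = -(B * θ ^ n) := by linarith
          have e2 := hnext x ⟨hx.1, hx.2.le⟩
          have e3 : ρ ^ (n + 1) * (B * θ ^ n) * -U (n + 1) x ≤
              ρ ^ (n + 1) * (B * θ ^ n) * (B * θ ^ (n + 1)) := by
            gcongr
            linarith
          have e4 : ρ ^ (n + 1) * (B * θ ^ n) * (B * θ ^ (n + 1)) =
              lam ^ (2 * n) * (B * θ ^ n) * (B * lam ^ 2) := by
            rw [pow_mul, ← hρθ]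
            ring
          have e5 : lam ^ (2 * n) * (B * θ ^ n) * (B * lam ^ 2) <
              lam ^ (2 * n) * (B * θ ^ n) * 1 :=
            mul_lt_mul_of_pos_left hB1 (by positivity)
          have e6 : 0 ≤ ρ ^ n * U (n - 1) x ^ 2 := by positivity
          simp only [vf, e1]
          linarith) ht
      linarith
  exact fun n hn => key (M + 1) n hn (by omega)

/-- Induction runs up from mode N: an upper bound needs the size of the forcing mode below and the
lower bound of the mode above. -/
lemma GalerkinSol.upper_bound {θ B₀ B T₀ : ℝ} {N : ℕ} (hlam : 1 < lam) (hρ : 0 < ρ)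
    (hθ : 0 < θ) (hρθ : ρ * θ = lam ^ 2) (hU : GalerkinSol lam ρ a M T A U) (hB : 0 < B)
    (hB0 : B₀ ≤ B) (hB1 : B * (lam ^ 2 * θ ^ 2 + 1) < θ ^ 2) (ha : ∀ n, N ≤ n → |a n| ≤ B₀ * θ ^ n)
    (hT₀ : T₀ ≤ T)
    (hN : ∀ t ∈ Icc 0 T₀, U N t ≤ B * θ ^ N) :
    ∀ n, N ≤ n → ∀ t ∈ Icc 0 T₀, |U n t| ≤ B * θ ^ n := by
  have hBlam : B * lam ^ 2 < 1 := by
    have : B * lam ^ 2 * θ ^ 2 < 1 * θ ^ 2 := by linarith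
    exact lt_of_mul_lt_mul_right this (by positivity)
  have hlow := hU.lower_bound hlam hρ hθ hρθ hB hB0 hBlam ha
  have hsub : ∀ t ∈ Icc 0 T₀, t ∈ Icc 0 T := fun t ht => ⟨ht.1, ht.2.trans hT₀⟩
  intro n hn
  induction n, hn using Nat.le_induction with
  | base => exact fun t ht => _root_.abs_le.2 ⟨hlow N le_rfl t (hsub t ht), hN t ht⟩
  | succ n hn ih =>
    intro t ht
    refine _root_.abs_le.2 ⟨hlow (n + 1) (by omega) t (hsub t ht), ?_⟩
    rcases lt_or_ge M (n + 1) with h | h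
    · rw [hU.above _ h]
      positivity
    refine image_le_of_deriv_right_lt_deriv_boundary' (f := U (n + 1))
      (f' := fun t => vf lam ρ (fun m => U m t) (n + 1)) (B := fun _ => B * θ ^ (n + 1))
      (B' := fun _ => 0) (hU.cont _).continuousOn
      (fun x hx => hU.deriv (n + 1) h x ⟨hx.1, hx.2.trans_le hT₀⟩)
      ?_ continuousOn_const (fun x _ => hasDerivWithinAt_const _ _ _) (fun x hx hxe => ?_) ht
    · rw [hU.initial _ h]
      have : B₀ * θ ^ (n + 1) ≤ B * θ ^ (n + 1) := by gcongr
      exact (le_abs_self _).trans ((ha _ (by omega)).trans this)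
    · have hxI : x ∈ Icc 0 T₀ := ⟨hx.1, hx.2.le⟩
      have e2 := hlow (n + 2) (by omega) x (hsub x hxI)
      have e1 : ρ ^ (n + 1) * U n x ^ 2 ≤ ρ ^ (n + 1) * (B * θ ^ n) ^ 2 := by
        rw [← sq_abs]
        gcongr
        exact ih x hxI
      have e3 : ρ ^ (n + 2) * (B * θ ^ (n + 1)) * -U (n + 2) x ≤
          ρ ^ (n + 2) * (B * θ ^ (n + 1)) * (B * θ ^ (n + 2)) := by
        gcongr
        linarith
      have e4 : ρ ^ (n + 1) * (B * θ ^ n) ^ 2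
          + ρ ^ (n + 2) * (B * θ ^ (n + 1)) * (B * θ ^ (n + 2)) =
          ρ ^ (n + 1) * θ ^ (2 * n) * B * (B * (lam ^ 2 * θ ^ 2 + 1)) := by
        rw [← hρθ]
        ring
      have e5 : ρ ^ (n + 1) * θ ^ (2 * n) * B * (B * (lam ^ 2 * θ ^ 2 + 1)) <
          ρ ^ (n + 1) * θ ^ (2 * n) * B * θ ^ 2 :=
        mul_lt_mul_of_pos_left hB1 (by positivity)
      have e6 : ρ ^ (n + 1) * θ ^ (2 * n) * B * θ ^ 2 =
          lam ^ (2 * (n + 1)) * (B * θ ^ (n + 1)) := by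
        rw [pow_mul lam, ← hρθ]
        ring
      simp only [vf, Nat.add_sub_cancel, hxe]
      linarith

end Bounds

/-- Existence of a solution with the energy inequality, which stays small in the high modes for a
short time if its data are small there. -/
theorem exists_sol {lam ρ A : ℝ} (hlam : 1 < lam) (hρ : 0 < ρ) (a : ℕ → ℝ) (ha0 : a 0 = 0)
    (hA : ∀ M, ∑ m ∈ range M, a m ^ 2 ≤ A) :
    ∃ u, Sol lam ρ u ∧ EnergyLe lam u A ∧ (∀ n, u n 0 = a n) ∧
      ∀ (θ B₀ B : ℝ) (N : ℕ), 0 < θ → ρ * θ = lam ^ 2 → 0 < B → B₀ < B →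
        B * (lam ^ 2 * θ ^ 2 + 1) < θ ^ 2 → (∀ n, N ≤ n → |a n| ≤ B₀ * θ ^ n) →
        ∃ T > 0, ∀ n, N ≤ n → ∀ t ∈ Icc 0 T, |u n t| ≤ B * θ ^ n := by
  have hA0 : 0 ≤ A := by simpa using hA 0
  choose U hU using fun M : ℕ => exists_galerkinSol M (A := A) (T := M + 1) hlam hρ a ha0 hA
    (by positivity)
  -- An ultrafilter limit exists for all bounded values at once and replaces a diagonal subsequence.
  let l : Ultrafilter ℕ := Filter.hyperfilter ℕ
  have hl : (l : Filter ℕ) ≤ atTop := Nat.hyperfilter_le_atTop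
  have hlim : ∀ n t, ∃ y, Tendsto (fun M => U M n t) l (𝓝 y) := fun n t => by
    obtain ⟨y, _, hy⟩ := isCompact_Icc.ultrafilter_le_nhds (l.map fun M => U M n t)
      (s := Icc (-√A) √A) (le_principal_iff.2 (Filter.mem_map.2
        (Filter.univ_mem' fun M => abs_le.1 ((hU M).abs_le n t))))
    exact ⟨y, hy⟩
  choose u hu using hlim
  have hequi : ∀ n, EquiLip fun M => U M n := fun n =>
    ⟨√A, _, by positivity, by positivity, fun M t => (hU M).abs_le n t, fun M s t => (hU M).lip n s t⟩
  have hcont : ∀ n, Continuous (u n) := fun n => (hequi n).continuous_limit (hu n)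
  have hzero : ∀ t, u 0 t = 0 := fun t =>
    tendsto_nhds_unique (hu 0 t) (by simp_rw [(hU _).zero]; exact tendsto_const_nhds)
  have hinit : ∀ n, u n 0 = a n := fun n => by
    refine tendsto_nhds_unique (hu n 0) (tendsto_const_nhds.congr' ?_)
    filter_upwards [hl (eventually_ge_atTop n)] with M hM
    exact ((hU M).initial n hM).symm
  have hTlarge : ∀ t : ℝ, ∀ᶠ M : ℕ in l, t ≤ M := fun t =>
    (tendsto_natCast_atTop_atTop.mono_left hl).eventually_ge_atTop t
  have hint : ∀ n t, 0 ≤ t → u n t = a n + ∫ s in (0 : ℝ)..t, vf lam ρ (fun m => u m s) n := by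
    intro n t ht
    have hv : EquiLip fun M s => vf lam ρ (fun m => U M m s) n := by
      have e := (((EquiLip.const (-lam ^ (2 * n))).mul (hequi n)).add
        ((EquiLip.const (ρ ^ n)).mul ((hequi (n - 1)).mul (hequi (n - 1))))).add
        ((EquiLip.const (-ρ ^ (n + 1))).mul ((hequi n).mul (hequi (n + 1))))
      convert e using 3
      simp only [vf]
      ring
    have hvl : ∀ s, Tendsto (fun M => vf lam ρ (fun m => U M m s) n) l
        (𝓝 (vf lam ρ (fun m => u m s) n)) := fun s =>
      (((hu n s).const_mul _).neg.add (((hu (n - 1) s).pow 2).const_mul _)).sub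
        (((hu n s).const_mul _).mul (hu (n + 1) s))
    refine tendsto_nhds_unique (hu n t) (((hv.tendsto_integral hvl ht).const_add (a n)).congr' ?_)
    filter_upwards [hl (eventually_ge_atTop n), hTlarge t] with M hM hMt
    have h1 := intervalIntegral.integral_eq_sub_of_hasDeriv_right_of_le ht
      ((hU M).cont n).continuousOn
      (fun s hs => ((hU M).deriv n hM s ⟨hs.1.le, by linarith [hs.2]⟩).mono Ioi_subset_Ici_self)
      ((continuous_vf (hU M).cont n).intervalIntegrable _ _)
    rw [h1, (hU M).initial n hM]
    ring
  refine ⟨u, ⟨hcont, hzero, fun n t ht => ?_⟩, fun K t ht => ?_, hinit, ?_⟩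
  · have h1 : HasDerivWithinAt (fun t => a n + ∫ s in (0 : ℝ)..t, vf lam ρ (fun m => u m s) n)
        (vf lam ρ (fun m => u m t) n) (Ici t) t :=
      (((continuous_vf hcont n).integral_hasStrictDerivAt 0 t).hasDerivAt.const_add
        _).hasDerivWithinAt
    exact h1.congr (fun s hs => hint n s (ht.trans hs)) (hint n t ht)
  · have h1 : Tendsto (fun M => ∑ n ∈ range K, (U M n t ^ 2 + 2 * diss lam (U M) n 0 t)) l
        (𝓝 (∑ n ∈ range K, (u n t ^ 2 + 2 * diss lam u n 0 t))) := by
      refine tendsto_finsetSum _ fun n _ => ((hu n t).pow 2).add (Tendsto.const_mul 2 ?_)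
      refine EquiLip.tendsto_integral (F := fun M s => lam ^ (2 * n) * U M n s ^ 2) ?_
        (fun s => ((hu n s).pow 2).const_mul _) ht
      simp_rw [sq]
      exact (EquiLip.const _).mul ((hequi n).mul (hequi n))
    refine le_of_tendsto h1 ?_
    filter_upwards [hl (eventually_ge_atTop K), hTlarge t] with M hM hMt
    exact (hU M).energy_le hA hM ⟨ht, by linarith⟩
  · intro θ B₀ B N hθ hρθ hB hB0 hB1 ha
    set L := lam ^ (2 * N) * √A + ρ ^ N * A + ρ ^ (N + 1) * A
    have hL : 0 ≤ L := by positivity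
    have hgap : 0 < (B - B₀) * θ ^ N := mul_pos (sub_pos.2 hB0) (by positivity)
    -- Mode N moves at speed at most L for every M, so it needs at least this time to cross the gap
    -- from B₀ θ^N to B θ^N. The cap 1 stays within every Galerkin interval [0, M + 1].
    refine ⟨min 1 ((B - B₀) * θ ^ N / (L + 1)), by positivity, fun n hn t ht => ?_⟩
    refine le_of_tendsto (hu n t).abs ?_
    filter_upwards [hl (eventually_ge_atTop N)] with M hM
    refine (hU M).upper_bound hlam hρ hθ hρθ hB hB0.le hB1 ha
      ((min_le_left _ _).trans (by linarith [(Nat.cast_nonneg M : (0 : ℝ) ≤ M)]))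
      (fun s hs => ?_) n hn t ht
    have h1 := (hU M).lip N s 0
    rw [(hU M).initial N hM, sub_zero, abs_of_nonneg hs.1] at h1
    have h2 : L * s ≤ (B - B₀) * θ ^ N := by
      have h3 := (hs.2.trans (min_le_right _ _))
      rw [le_div_iff₀ (by positivity)] at h3
      nlinarith [hs.1]
    have h4 := le_abs_self (U M N s - a N)
    have h5 := (le_abs_self _).trans (ha N le_rfl)
    linarith

end DyadicModel

/-! ### Translation between the two notions of solution and of the smallness hypothesis. -/

namespace DyadicModel

open Finset (range)

section Conversion

variable {lam β : ℝ} {a : ℕ → ℝ} {u : ℕ → ℝ → ℝ}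

lemma rpow_mul_natCast_add_one (hlam : 0 < lam) (β : ℝ) (n : ℕ) :
    lam ^ (β * ((n : ℝ) + 1)) = (lam ^ β) ^ (n + 1) := by
  rw [Real.rpow_mul hlam.le, ← Nat.cast_succ, Real.rpow_natCast]

lemma rpow_mul_natCast (hlam : 0 < lam) (β : ℝ) (n : ℕ) :
    lam ^ (β * (n : ℝ)) = (lam ^ β) ^ n := by
  rw [Real.rpow_mul hlam.le, Real.rpow_natCast]

lemma sol_of_isWeakSolution (hlam : 0 < lam) (hu : Dyadic.IsWeakSolution lam β a u) :
    Sol lam (lam ^ β) fun n t => u n (max t 0) := by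
  have hmax : ∀ t : ℝ, max t 0 ∈ Ici (0 : ℝ) := fun t => mem_Ici.2 (le_max_right _ _)
  have hz : (fun t => u 0 (max t 0)) = fun _ => 0 := funext fun t => hu.zero_index _ (hmax t)
  refine ⟨fun n => ?_, fun t => hu.zero_index _ (hmax t), fun n t ht => ?_⟩
  · rcases Nat.eq_zero_or_pos n with rfl | hn
    · rw [hz]
      exact continuous_const
    · exact (hu.smooth n hn).continuousOn.comp_continuous (by fun_prop) hmax
  · simp only [max_eq_left ht]
    rcases Nat.eq_zero_or_pos n with rfl | hn
    · rw [hz]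
      refine (hasDerivWithinAt_const t (Ici t) (0 : ℝ)).congr_deriv ?_
      simp [vf, hu.zero_index t ht]
    · have h1 := (((hu.smooth n hn).differentiableOn (by simp)) t ht).hasDerivWithinAt
      have h2 := h1.mono (Ici_subset_Ici.2 ht)
      have h3 := hu.equation n hn t ht
      rw [rpow_mul_natCast_add_one hlam, rpow_mul_natCast hlam] at h3
      refine (h2.congr (fun s hs => ?_) ?_).congr_deriv ?_
      · rw [max_eq_left (ht.trans hs)]
      · rw [max_eq_left ht]
      · simp only [vf]
        linarith

lemma energyLe_of_isLerayHopfSolution (hu : Dyadic.IsLerayHopfSolution lam β a u) :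
    EnergyLe lam (fun n t => u n (max t 0)) (∑' n : ℕ, a (n + 1) ^ 2) := by
  intro M t ht
  have hdiss : ∀ n, diss lam (fun n t => u n (max t 0)) n 0 t =
      ∫ τ in (0 : ℝ)..t, lam ^ (2 * n) * u n τ ^ 2 := fun n =>
    intervalIntegral.integral_congr fun s hs => by
      rw [uIcc_of_le ht] at hs
      simp only [max_eq_left hs.1]
  have hterm : ∀ n, u n (max t 0) ^ 2 + 2 * diss lam (fun n t => u n (max t 0)) n 0 t =
      Dyadic.energyTerm lam u n t := fun n => by
    rw [hdiss, max_eq_left ht, Dyadic.energyTerm]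
  have hnonneg : ∀ n, 0 ≤ Dyadic.energyTerm lam u n t := fun n => by
    rw [← hterm]
    have := diss_nonneg lam (fun n t => u n (max t 0)) n ht
    positivity
  have h0 : Dyadic.energyTerm lam u 0 t = 0 := by
    rw [← hterm]
    have : ∀ s, u 0 (max s 0) = 0 := fun s => hu.weak.zero_index _ (le_max_right _ _)
    simp [diss, this]
  simp only [hterm]
  calc ∑ n ∈ range M, Dyadic.energyTerm lam u n t
      ≤ ∑ n ∈ range (M + 1), Dyadic.energyTerm lam u n t := by
        rw [Finset.sum_range_succ]
        exact le_add_of_nonneg_right (hnonneg M)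
    _ = ∑ n ∈ range M, Dyadic.energyTerm lam u (n + 1) t := by
        rw [Finset.sum_range_succ', h0, add_zero]
    _ ≤ ∑' n, Dyadic.energyTerm lam u (n + 1) t :=
        (hu.summable_energy t ht).sum_le_tsum _ fun n _ => hnonneg (n + 1)
    _ ≤ _ := hu.energy_le t ht

lemma Sol.hasDerivWithinAt_Ici {ρ : ℝ} (hu : Sol lam ρ u) (n : ℕ) {t : ℝ} (ht : 0 ≤ t) :
    HasDerivWithinAt (u n) (vf lam ρ (fun m => u m t) n) (Ici 0) t := by
  have hint : ∀ s, 0 ≤ s → u n s = u n 0 + ∫ r in (0 : ℝ)..s, vf lam ρ (fun m => u m r) n :=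
    fun s hs => by
      rw [integral_eq_of_right_deriv hs (hu.cont n) (continuous_vf hu.cont n)
        fun r hr => hu.deriv n r hr]
      ring
  have h1 : HasDerivWithinAt (fun t => u n 0 + ∫ s in (0 : ℝ)..t, vf lam ρ (fun m => u m s) n)
      (vf lam ρ (fun m => u m t) n) (Ici 0) t :=
    (((continuous_vf hu.cont n).integral_hasStrictDerivAt 0 t).hasDerivAt.const_add
      _).hasDerivWithinAt
  exact h1.congr hint (hint t ht)

/-- Bootstrap over all modes together: the derivative of a mode is a polynomial in itself and its
two neighbours. -/
lemma Sol.contDiffOn {ρ : ℝ} (hu : Sol lam ρ u) (n : ℕ) : ContDiffOn ℝ ∞ (u n) (Ici 0) := by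
  have hderiv : ∀ n, EqOn (derivWithin (u n) (Ici 0)) (fun t => vf lam ρ (fun m => u m t) n) (Ici 0) :=
    fun n t ht => (hu.hasDerivWithinAt_Ici n ht).derivWithin (uniqueDiffOn_Ici 0 t ht)
  have key : ∀ k : ℕ, ∀ n, ContDiffOn ℝ k (u n) (Ici 0) := by
    intro k
    induction k with
    | zero => exact fun n => contDiffOn_zero.2 (hu.cont n).continuousOn
    | succ k ih =>
      intro n
      push_cast
      refine (contDiffOn_succ_iff_derivWithin (uniqueDiffOn_Ici 0)).2
        ⟨fun t ht => (hu.hasDerivWithinAt_Ici n ht).differentiableWithinAt, by simp, ?_⟩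
      refine ContDiffOn.congr ?_ (hderiv n)
      have h1 := ih n
      have h2 := ih (n - 1)
      have h3 := ih (n + 1)
      simp only [vf]
      fun_prop
  exact contDiffOn_infty.2 fun k => key k n

lemma isLerayHopfSolution_of_sol (hlam : 0 < lam) (hu : Sol lam (lam ^ β) u)
    (hA : EnergyLe lam u (∑' n : ℕ, a (n + 1) ^ 2)) (hinit : ∀ n, 1 ≤ n → u n 0 = a n) :
    Dyadic.IsLerayHopfSolution lam β a u := by
  have hsum : ∀ t, 0 ≤ t → ∀ M, ∑ n ∈ range M, Dyadic.energyTerm lam u (n + 1) t ≤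
      ∑' n : ℕ, a (n + 1) ^ 2 := fun t ht M => by
    have h1 := hA (M + 1) t ht
    rw [Finset.sum_range_succ'] at h1
    have h2 := diss_nonneg lam u 0 ht
    have h3 := sq_nonneg (u 0 t)
    have h4 : ∑ n ∈ range M, Dyadic.energyTerm lam u (n + 1) t =
        ∑ n ∈ range M, (u (n + 1) t ^ 2 + 2 * diss lam u (n + 1) 0 t) := rfl
    linarith
  have hnonneg : ∀ t, 0 ≤ t → ∀ n, 0 ≤ Dyadic.energyTerm lam u (n + 1) t := fun t ht n => by
    have := diss_nonneg lam u (n + 1) ht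
    have h4 : Dyadic.energyTerm lam u (n + 1) t =
        u (n + 1) t ^ 2 + 2 * diss lam u (n + 1) 0 t := rfl
    rw [h4]
    positivity
  refine ⟨⟨fun t _ => hu.zero t, fun n _ => hu.contDiffOn n, fun n _ t ht => ?_, hinit⟩,
    fun t ht => summable_of_sum_range_le (hnonneg t ht) (hsum t ht),
    fun t ht => Real.tsum_le_of_sum_range_le (hnonneg t ht) (hsum t ht)⟩
  rw [(hu.hasDerivWithinAt_Ici n ht).derivWithin (uniqueDiffOn_Ici 0 t ht),
    rpow_mul_natCast_add_one hlam, rpow_mul_natCast hlam]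
  simp only [vf]
  ring

/-- The smallness hypotheses on the data give a bound by a constant below the threshold. -/
lemma exists_bound_lt_smallnessConst (hlam : 1 < lam)
    (h : (a =o[atTop] fun n : ℕ => lam ^ ((2 - β) * (n : ℝ))) ∨
      limsup (fun n : ℕ => ((|a n| * lam ^ ((β - 2) * (n : ℝ)) : ℝ) : EReal)) atTop
        < (Dyadic.smallnessConst lam β : EReal)) :
    ∃ B₀ < Dyadic.smallnessConst lam β, ∃ N, ∀ n, N ≤ n → |a n| ≤ B₀ * (lam ^ (2 - β)) ^ n := by
  have hlam0 : 0 < lam := by linarith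
  have hε : 0 < Dyadic.smallnessConst lam β := by
    unfold Dyadic.smallnessConst
    positivity
  rcases h with h | h
  · refine ⟨Dyadic.smallnessConst lam β / 2, half_lt_self hε, ?_⟩
    obtain ⟨N, hN⟩ := eventually_atTop.1 (h.bound (half_pos hε))
    refine ⟨N, fun n hn => ?_⟩
    have := hN n hn
    rwa [rpow_mul_natCast hlam0, Real.norm_eq_abs, Real.norm_eq_abs,
      abs_of_pos (by positivity : 0 < (lam ^ (2 - β)) ^ n)] at this
  · obtain ⟨B₀, h1, h2⟩ := EReal.lt_iff_exists_real_btwn.1 h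
    refine ⟨B₀, EReal.coe_lt_coe_iff.1 h2, ?_⟩
    obtain ⟨N, hN⟩ := eventually_atTop.1 (eventually_lt_of_limsup_lt h1)
    refine ⟨N, fun n hn => ?_⟩
    have h3 := (EReal.coe_lt_coe_iff.1 (hN n hn)).le
    have h4 : lam ^ ((β - 2) * (n : ℝ)) * (lam ^ (2 - β)) ^ n = 1 := by
      rw [← rpow_mul_natCast hlam0, ← Real.rpow_add hlam0]
      ring_nf
      exact Real.rpow_zero lam
    calc |a n| = |a n| * lam ^ ((β - 2) * (n : ℝ)) * (lam ^ (2 - β)) ^ n := by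
          rw [mul_assoc, h4, mul_one]
      _ ≤ _ := by gcongr

end Conversion

end DyadicModel

/-! ### Assembly of the theorem. -/

/-- For `β > 2` either the little-o condition or the weaker limsup condition is allowed; the limsup
is taken in the extended reals, so an unbounded sequence has limsup `⊤`. -/
theorem theorem0p7 (lam β : ℝ) (hlam : 1 < lam) (hβ : 0 < β)
    (a : ℕ → ℝ) (ha : Memℓp (fun n : ℕ => a (n + 1)) 2)
    (hsmall : 2 < β →
      (a =o[atTop] fun n : ℕ => lam ^ ((2 - β) * (n : ℝ))) ∨
      limsup (fun n : ℕ => ((|a n| * lam ^ ((β - 2) * (n : ℝ)) : ℝ) : EReal)) atTop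
        < (Dyadic.smallnessConst lam β : EReal)) :
    ∃ u : ℕ → ℝ → ℝ, Dyadic.IsLerayHopfSolution lam β a u ∧
      ∀ v : ℕ → ℝ → ℝ, Dyadic.IsLerayHopfSolution lam β a v →
        ∀ n : ℕ, ∀ t : ℝ, 0 ≤ t → v n t = u n t := by
  have hlam0 : 0 < lam := by linarith
  have hρ : 0 < lam ^ β := Real.rpow_pos_of_pos hlam0 β
  have hsum : Summable fun n : ℕ => a (n + 1) ^ 2 := by
    have := ha.summable (by norm_num)
    simpa using this
  set A := ∑' n : ℕ, a (n + 1) ^ 2 with hA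
  -- The value a 0 is arbitrary, whereas mode 0 must vanish.
  set b : ℕ → ℝ := fun n => if n = 0 then 0 else a n with hb
  have hbs : ∀ M, ∑ m ∈ Finset.range (M + 1), b m ^ 2 = ∑ m ∈ Finset.range M, a (m + 1) ^ 2 :=
    fun M => by
      rw [Finset.sum_range_succ']
      simp [hb]
  have hbA : ∀ M, ∑ m ∈ Finset.range M, b m ^ 2 ≤ A := fun M => by
    refine le_trans ?_ (hsum.sum_le_tsum (Finset.range M) fun _ _ => sq_nonneg _)
    rw [← hbs, Finset.sum_range_succ]
    exact le_add_of_nonneg_right (sq_nonneg _)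
  have hblim : Tendsto (fun M => ∑ m ∈ Finset.range M, b m ^ 2) atTop (𝓝 A) := by
    rw [← tendsto_add_atTop_iff_nat 1]
    simp_rw [hbs]
    exact hsum.hasSum.tendsto_sum_nat
  obtain ⟨u, hu, hEu, hinit, hsmallu⟩ := DyadicModel.exists_sol hlam hρ b (by simp [hb]) hbA
  have hulim : Tendsto (fun M => ∑ m ∈ Finset.range M, u m 0 ^ 2) atTop (𝓝 A) := by
    simpa only [hinit] using hblim
  refine ⟨u, DyadicModel.isLerayHopfSolution_of_sol hlam0 hu hEu fun n hn => ?_,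
    fun v hv n t ht => ?_⟩
  · rw [hinit]
    simp [hb, Nat.one_le_iff_ne_zero.1 hn]
  set w : ℕ → ℝ → ℝ := fun n t => v n (max t 0) with hw
  have hwS : DyadicModel.Sol lam (lam ^ β) w := DyadicModel.sol_of_isWeakSolution hlam0 hv.weak
  have hwE : DyadicModel.EnergyLe lam w A := DyadicModel.energyLe_of_isLerayHopfSolution hv
  have hw0 : ∀ n, u n 0 = w n 0 := fun n => by
    rcases Nat.eq_zero_or_pos n with rfl | hn
    · rw [hu.zero, hwS.zero]
    · rw [hinit]
      simp [hb, hw, hn.ne', hv.weak.initial n hn]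
  suffices u n t = w n t by rw [this]; simp [hw, ht]
  rcases le_or_gt β 2 with h2 | h2
  · have hle : lam ^ β ≤ lam ^ 2 := by
      rw [← Real.rpow_two]
      exact Real.rpow_le_rpow_of_exponent_le hlam.le h2
    refine DyadicModel.eq_of_tailSmall hlam hρ hu hwS hEu hwE le_rfl (fun m s hs => ?_)
      (DyadicModel.tailSmall_zero hlam hρ hle hulim) n ht
    rw [le_antisymm hs.2 hs.1]
    exact hw0 m
  · obtain ⟨B₁, hB₁, N, hN⟩ := DyadicModel.exists_bound_lt_smallnessConst hlam (hsmall h2)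
    set θ := lam ^ (2 - β) with hθdef
    have hθ : 0 < θ := Real.rpow_pos_of_pos hlam0 _
    have hθ1 : θ < 1 := Real.rpow_lt_one_of_one_lt_of_neg hlam (by linarith)
    have hρθ : lam ^ β * θ = lam ^ 2 := by
      rw [← Real.rpow_add hlam0, ← Real.rpow_two]
      ring_nf
    have hε : 0 < Dyadic.smallnessConst lam β := by
      unfold Dyadic.smallnessConst
      positivity
    -- The sign of B₁ is not recorded; the maximum with 0 forces B > 0. The strict gap above it lets
    -- the bound persist for a short time.
    obtain ⟨B, hB₀B, hBε⟩ := exists_between (max_lt hB₁ hε)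
    have hB : 0 < B := (le_max_right _ _).trans_lt hB₀B
    have hB1 : B * (lam ^ 2 + lam ^ β / lam) ≤ 1 := by
      have h3 := (hBε.trans_le (min_le_left _ _)).le
      rwa [le_div_iff₀ (by positivity), Real.rpow_sub_one hlam0.ne'] at h3
    -- The second entry of ε, multiplied by θ² = λ^(4-2β).
    have hB2 : B * (lam ^ 2 * θ ^ 2 + 1) < θ ^ 2 := by
      have h3 := hBε.trans_le (min_le_right _ _)
      rw [lt_div_iff₀ (by positivity)] at h3
      have h4 : lam ^ (2 * β - 4) * θ ^ 2 = 1 := by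
        rw [hθdef, ← Real.rpow_mul_natCast hlam0.le, ← Real.rpow_add hlam0]
        norm_num
        ring_nf
        exact Real.rpow_zero lam
      have h5 : B * (lam ^ 2 + lam ^ (2 * β - 4)) * θ ^ 2 < 1 * θ ^ 2 := by gcongr
      calc B * (lam ^ 2 * θ ^ 2 + 1) = B * (lam ^ 2 * θ ^ 2 + lam ^ (2 * β - 4) * θ ^ 2) := by
            rw [h4]
        _ = B * (lam ^ 2 + lam ^ (2 * β - 4)) * θ ^ 2 := by ring
        _ < θ ^ 2 := by rwa [one_mul] at h5
    have hbN : ∀ n, N ≤ n → |b n| ≤ max B₁ 0 * θ ^ n := fun n hn => by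
      rcases Nat.eq_zero_or_pos n with rfl | hn0
      · simp [hb]
      · have : |a n| ≤ max B₁ 0 * θ ^ n :=
          (hN n hn).trans (mul_le_mul_of_nonneg_right (le_max_left _ _) (by positivity))
        simpa [hb, hn0.ne'] using this
    obtain ⟨T, hT, hTu⟩ := hsmallu θ _ B N hθ hρθ hB hB₀B hB2 hbN
    have hκ : B * (lam ^ 2 * θ ^ 2 + 1) ≤ B * (lam ^ 2 * θ ^ 2 + 1) / θ ^ 2 * θ ^ 2 := by
      rw [div_mul_cancel₀ _ (by positivity)]
    exact DyadicModel.eq_of_tailSmall hlam hρ hu hwS hEu hwE hT.le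
      (fun m s hs => DyadicModel.weak_strong_uniqueness hlam hρ hρθ hu hwS hEu hwE hw0 hulim hB.le
        hB1 hTu m hs)
      (DyadicModel.tailSmall_of_small hlam hρ hθ hθ1 hρθ hu hEu hulim hB
        ((div_lt_one (by positivity)).2 hB2) hκ hT hTu) n ht
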